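/- Let $d\in\{2,3\}$, let $\Omega\subset\mathbb R^d$ be a bounded open set and let $\mathcal T_h$ be a partition of $\Omega$ into finitely many closed polytopes with pairwise disjoint connected interiors, of arbitrary mesh size $h>0$. Let $\mathcal E_h$ be the set of its edges ($d=2$) or flat faces ($d=3$), each $e\in\mathcal E_h$ being either contained in $\partial\Omega$ or interior, with a fixed unit normal $\mathbf n_e$. Let $k\ge 2$, and let $P_m(D)$ be the space of polynomials of total degree at most $m$ on $D$. Put $$V_h=\{v=(v_0,v_b,v_n): v_0|_T\in P_k(T),\ v_b|_e\in P_k(e),\ v_n|_e\in P_{k-1}(e)\ \text{for all } T\in\mathcal T_h,\ e\in\mathcal E_h\},$$ and let $V_h^0$ be the subspace of those $v\in V_h$ with $v_b|_e=0$ and $v_n|_e=0$ for $e\subset\partial\Omega$. For $j\ge 0$ the weak Laplacian $\Delta_w v$ of $v\in V_h$ is the piecewise polynomial with $\Delta_wv|_T\in P_j(T)$ and $$(\Delta_w v,\varphi)_T=(v_0,\Delta\varphi)_T-\langle v_b,\nabla\varphi\cdot\mathbf n\rangle_{\partial T}+\langle v_n\,\mathbf n_e\cdot\mathbf n,\varphi\rangle_{\partial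 T}\qquad\forall\varphi\in P_j(T),$$ where $\mathbf n$ is the outward unit normal of $T$. For $\psi\in H^2_0(\Omega)$ let $Q_h\psi=(Q_0\psi,Q_b\psi,Q_n(\nabla\psi\cdot\mathbf n_e))\in V_h^0$, where $Q_0,Q_b,Q_n$ are the $L^2$ projections onto $P_k(T)$, $P_k(e)$, $P_{k-1}(e)$. Let $\bar t>0$, $f\in L^2(0,\bar t;L^2(\Omega))$ and $\psi\in H^2_0(\Omega)$. A solution of the semi-discrete scheme is a map $u_h:[0,\bar t]\to V_h^0$ with $u_h(0)=Q_h\psi$ that coincides on $(0,\bar t]$ with the continuous representative of an element of $H^1(0,\bar t;V_h^0)$, whose interior component $u_{h,0}$ is continuous at $t=0$ too, and that satisfies, for almost every $t\in(0,\bar t)$, $$(\partial_t u_{h,0},v_0)+(\Delta_wu_h,\Delta_wv)=(f(t),v_0)\qquad\forall v=(v_0,v_b,v_n)\in V_h^0 .$$ **Theorem.** (1) For every $j\ge 0$ the semi-discrete scheme has a solution. There is one whose continuous representative in $H^1(0,\bar t;V_h^0)$ takes the value $Q_h\psi$ at $t=0$ in all three components if and only if $(\Delta_wQ_h\psi,\Delta_wv)=0$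 for all $v\in V_h^0$ with $v_0=0$. (2) There is a $j_0$, depending only on the partition and on $k$, such that the following holds for all $j\ge j_0$ and all $\bar t,f,\psi$ as above. The solution is unique. Moreover, let $(\varphi_i)$ be a basis of the space of the components $v_0$, and let $(\psi_i)$ and $(\varsigma_i)$ be bases of the spaces of the components $v_b$ and $v_n$ of elements of $V_h^0$. Let $x_i=(\varphi_i,0,0)$, let $(y_l)$ be the family of the $(0,\psi_i,0)$ followed by the $(0,0,\varsigma_i)$, and put $C=[(\varphi_l,\varphi_i)]_{i,l}$, $A_{00}=[(\Delta_wx_l,\Delta_wx_i)]_{i,l}$, $A_{0B}=[(\Delta_wy_l,\Delta_wx_i)]_{i,l}$, $A_{B0}=A_{0B}^T$, $A_{BB}=[(\Delta_wy_l,\Delta_wy_i)]_{i,l}$ and $\mathbf f(t)=[(f(t),\varphi_i)]_i$. Then $C$ and $A_{BB}$ are invertible, and a map $u_h:[0,\bar t]\to V_h^0$ is the solution of the semi-discrete scheme if and only if $u_h(0)=Q_h\psi$ and there is $\mathbf b\in H^1(0,\bar t;\mathbb R^M)$, $M$ being the number of the $\varphi_i$, such that $\mathbf b(0)$ is the coefficient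 vector of $Q_0\psi$, $$\mathbf b'(t)=C^{-1}\mathbf f(t)+C^{-1}\bigl(A_{0B}A_{BB}^{-1}A_{B0}-A_{00}\bigr)\mathbf b(t)\quad\text{for almost every }t\in(0,\bar t),$$ and, for all $t\in(0,\bar t]$, $u_h(t)=\sum_i b_i(t)\,x_i+\sum_l\bigl(-A_{BB}^{-1}A_{B0}\mathbf b(t)\bigr)_l\,y_l$. -/

import Mathlib

open MeasureTheory Filter Topology Set
open scoped ContDiff

noncomputable section

namespace SFWG

/-- The space `ℝ^d` with its Euclidean norm. -/
abbrev E (d : ℕ) : Type := EuclideanSpace ℝ (Fin d)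

/-! ### Polytopal partitions -/

/-- A (possibly nonconvex) closed bounded polytope: a finite union of convex hulls of finite
sets of points. -/
def IsPolytope {d : ℕ} (S : Set (E d)) : Prop :=
  ∃ F : Set (Set (E d)), F.Finite ∧ (∀ s ∈ F, s.Finite) ∧ S = ⋃ s ∈ F, convexHull ℝ s

/-- `ν` points out of the element `T` at all points of the relative interior of the flat
piece `e` of its boundary. -/
def IsOutward {d : ℕ} (T e : Set (E d)) (ν : E d) : Prop :=
  ∀ x ∈ intrinsicInterior ℝ e, ∀ᶠ s in 𝓝[>] (0 : ℝ), x - s • ν ∈ interior T ∧ x + s • ν ∉ T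

/-- A partition of `Ω` into polytopes, together with the set of all its edges (`d = 2`) or flat
faces (`d = 3`) and the choice of a unit normal `n_e` on each of them. The boundary of an element
is the union of the edges/faces contained in it. -/
structure PolytopalMesh (d : ℕ) (Ω : Set (E d)) where
  elems : Finset (Set (E d))
  faces : Finset (Set (E d))
  /-- the fixed normal `n_e` -/
  normal : Set (E d) → E d
  elem_polytope : ∀ T ∈ elems, IsPolytope T
  elem_regular : ∀ T ∈ elems, closure (interior T) = T
  elem_connected : ∀ T ∈ elems, IsConnected (interior T)
  elem_subset : ∀ T ∈ elems, interior T ⊆ Ω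
  elem_disjoint : ∀ T ∈ elems, ∀ T' ∈ elems, T ≠ T' → Disjoint (interior T) (interior T')
  elem_cover : (⋃ T ∈ elems, T) = closure Ω
  face_polytope : ∀ e ∈ faces, IsPolytope e
  face_regular : ∀ e ∈ faces, closure (intrinsicInterior ℝ e) = e
  face_connected : ∀ e ∈ faces, IsConnected (intrinsicInterior ℝ e)
  face_dim : ∀ e ∈ faces, Module.finrank ℝ (affineSpan ℝ e).direction + 1 = d
  face_disjoint : ∀ e ∈ faces, ∀ e' ∈ faces, e ≠ e' →
    Disjoint (intrinsicInterior ℝ e) (intrinsicInterior ℝ e')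
  face_incident : ∀ e ∈ faces, ∃ T ∈ elems, e ⊆ frontier T
  /-- an edge/face is a boundary one or an interior one -/
  face_boundary : ∀ e ∈ faces, e ⊆ frontier Ω ∨ intrinsicInterior ℝ e ⊆ Ω
  frontier_elem : ∀ T ∈ elems, frontier T = ⋃ e ∈ {e | e ∈ faces ∧ e ⊆ frontier T}, e
  normal_unit : ∀ e ∈ faces, ‖normal e‖ = 1
  normal_orth : ∀ e ∈ faces, ∀ x ∈ e, ∀ y ∈ e, inner ℝ (normal e) (x - y) = 0
  normal_outward : ∀ T ∈ elems, ∀ e ∈ faces, e ⊆ frontier T →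
    IsOutward T e (normal e) ∨ IsOutward T e (-normal e)

variable {d : ℕ} {Ω : Set (E d)}

open scoped Classical in
/-- The outward unit normal `n` of the element `T` on the edge/face `e ⊆ ∂T`. -/
def PolytopalMesh.outNormal (M : PolytopalMesh d Ω) (T e : Set (E d)) : E d :=
  if IsOutward T e (M.normal e) then M.normal e else -M.normal e

open scoped Classical in
/-- The edges/faces that make up `∂T`. -/
def PolytopalMesh.facesOf (M : PolytopalMesh d Ω) (T : Set (E d)) : Finset M.faces :=
  Finset.univ.filter fun e => e.1 ⊆ frontier T

/-! ### Polynomials and integrals -/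

/-- Evaluation of a polynomial at a point of `ℝ^d`. -/
def peval (p : MvPolynomial (Fin d) ℝ) (x : E d) : ℝ := MvPolynomial.eval (fun i => x i) p

/-- The Laplacian of a polynomial. -/
def plaplace (p : MvPolynomial (Fin d) ℝ) : MvPolynomial (Fin d) ℝ :=
  ∑ i, MvPolynomial.pderiv i (MvPolynomial.pderiv i p)

/-- The derivative `∇p(x) · n` of a polynomial. -/
def pnormal (p : MvPolynomial (Fin d) ℝ) (n x : E d) : ℝ :=
  ∑ i, peval (MvPolynomial.pderiv i p) x * n i

/-- Restriction of a polynomial to a set, as a linear map. -/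
def prestrict (D : Set (E d)) : MvPolynomial (Fin d) ℝ →ₗ[ℝ] (D → ℝ) where
  toFun p x := peval p x
  map_add' p q := by ext x; simp [peval]
  map_smul' c p := by ext x; simp [peval]

/-- `P_m(D)`: the functions on `D` that are restrictions of polynomials of total degree at most
`m`. -/
def polyOn (m : ℕ) (D : Set (E d)) : Submodule ℝ (D → ℝ) :=
  (MvPolynomial.restrictTotalDegree (Fin d) ℝ m).map (prestrict D)

/-- Lebesgue measure on `T`. -/
def volOn (T : Set (E d)) : Measure T := (volume : Measure (E d)).comap Subtype.val

/-- The `(d-1)`-dimensional surface measure on `e` (the arc length for `d = 2`, the area for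
`d = 3`). -/
def surfOn (e : Set (E d)) : Measure e :=
  (Measure.euclideanHausdorffMeasure (d - 1) : Measure (E d)).comap Subtype.val

open scoped Classical in
/-- The `L²` projection of `g` onto a space `S` of functions on `D`. -/
def l2proj {D : Set (E d)} (μ : Measure D) (S : Submodule ℝ (D → ℝ)) (g : D → ℝ) : S :=
  if h : ∃ q : S, ∀ p : S, ∫ x, q.1 x * p.1 x ∂μ = ∫ x, g x * p.1 x ∂μ then h.choose else 0

/-! ### Weak functions -/

/-- `V_h`: triples `(v_0, v_b, v_n)` with `v_0 ∈ P_k(T)` on each element and `v_b ∈ P_k(e)`,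
`v_n ∈ P_{k-1}(e)` on each edge/face. -/
abbrev Vh (M : PolytopalMesh d Ω) (k : ℕ) : Type :=
  (∀ T : M.elems, polyOn k T.1) ×
    ((∀ e : M.faces, polyOn k e.1) × (∀ e : M.faces, polyOn (k - 1) e.1))

/-- Piecewise polynomials of degree at most `m` on the edges/faces that vanish on those contained
in `∂Ω`. -/
def faceSpace (M : PolytopalMesh d Ω) (m : ℕ) : Submodule ℝ (∀ e : M.faces, polyOn m e.1) where
  carrier := {v | ∀ e : M.faces, e.1 ⊆ frontier Ω → v e = 0}
  add_mem' := by
    intro a b ha hb e he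
    simp [ha e he, hb e he]
  zero_mem' := by
    intro e _
    rfl
  smul_mem' := by
    intro c a ha e he
    simp [ha e he]

/-- `V_h^0`: the weak functions in `V_h` with `v_b = v_n = 0` on `∂Ω`. -/
def Vh0 (M : PolytopalMesh d Ω) (k : ℕ) : Submodule ℝ (Vh M k) :=
  (⊤ : Submodule ℝ _).prod ((faceSpace M k).prod (faceSpace M (k - 1)))

variable {k : ℕ}

/-- `p = Δ_w v` on `T`, for the weak Laplacian with values in `P_j(T)`. -/
def IsWeakLaplacian (M : PolytopalMesh d Ω) (j : ℕ) (v : Vh M k) (T : M.elems)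
    (p : MvPolynomial (Fin d) ℝ) : Prop :=
  p ∈ MvPolynomial.restrictTotalDegree (Fin d) ℝ j ∧
    ∀ φ ∈ MvPolynomial.restrictTotalDegree (Fin d) ℝ j,
      ∫ x, peval p x * peval φ x ∂(volOn T.1)
        = ∫ x, (v.1 T).1 x * peval (plaplace φ) x ∂(volOn T.1)
          - ∑ e ∈ M.facesOf T.1,
              ∫ x, (v.2.1 e).1 x * pnormal φ (M.outNormal T.1 e.1) x ∂(surfOn e.1)
          + ∑ e ∈ M.facesOf T.1,
              ∫ x, (v.2.2 e).1 x * inner ℝ (M.normal e.1) (M.outNormal T.1 e.1) * peval φ x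
                ∂(surfOn e.1)

open scoped Classical in
/-- The weak Laplacian `Δ_w v` on the element `T`. -/
def weakLaplacian (M : PolytopalMesh d Ω) (j : ℕ) (v : Vh M k) (T : M.elems) :
    MvPolynomial (Fin d) ℝ :=
  if h : ∃ p, IsWeakLaplacian M j v T p then h.choose else 0

/-- `(Δ_w u, Δ_w v)`. -/
def aw (M : PolytopalMesh d Ω) (j : ℕ) (u v : Vh M k) : ℝ :=
  ∑ T : M.elems,
    ∫ x, peval (weakLaplacian M j u T) x * peval (weakLaplacian M j v T) x ∂(volOn T.1)

/-- `(u_0, v_0)`. -/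
def ip0 (M : PolytopalMesh d Ω) (u v : ∀ T : M.elems, polyOn k T.1) : ℝ :=
  ∑ T : M.elems, ∫ x, (u T).1 x * (v T).1 x ∂(volOn T.1)

/-- `(g, v_0)` for a function `g` on `Ω`. -/
def load (M : PolytopalMesh d Ω) (g : E d → ℝ) (v : ∀ T : M.elems, polyOn k T.1) : ℝ :=
  ∑ T : M.elems, ∫ x, g x * (v T).1 x ∂(volOn T.1)

/-! ### The space `H²_0(Ω)`, traces, and the projection `Q_h` -/

/-- `φ ∈ C_c^∞(Ω)`. -/
def IsTest (Ω : Set (E d)) (φ : E d → ℝ) : Prop :=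
  ContDiff ℝ ∞ φ ∧ HasCompactSupport φ ∧ tsupport φ ⊆ Ω

/-- The square of the `H²(Ω)` norm of a smooth function. -/
def h2normSq (Ω : Set (E d)) (φ : E d → ℝ) : ℝ :=
  ∑ m ∈ Finset.range 3, ∫ x in Ω, ‖iteratedFDeriv ℝ m φ x‖ ^ 2

/-- The sequence `φ_n` in `C_c^∞(Ω)` converges to `ψ` in `H²(Ω)`: it is Cauchy in `H²(Ω)` and
converges to `ψ` in `L²(Ω)`. -/
def Approx (Ω : Set (E d)) (φ : ℕ → E d → ℝ) (ψ : E d → ℝ) : Prop :=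
  (∀ n, IsTest Ω (φ n)) ∧
    (∀ ε > 0, ∃ N : ℕ, ∀ m ≥ N, ∀ n ≥ N, h2normSq Ω (φ m - φ n) < ε) ∧
    Tendsto (fun n => ∫ x in Ω, (φ n x - ψ x) ^ 2) atTop (𝓝 0)

/-- `ψ ∈ H²_0(Ω)`, the closure of `C_c^∞(Ω)` in `H²(Ω)`. -/
def MemH20 (Ω : Set (E d)) (ψ : E d → ℝ) : Prop :=
  MemLp ψ 2 (volume.restrict Ω) ∧ ∃ φ, Approx Ω φ ψ

/-- `g` is the trace on `e` of `B ψ`, where `B` is the identity or a first order derivative: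
the continuous extension of `φ ↦ (B φ)|_e` from `C_c^∞(Ω)` to `H²_0(Ω)`. -/
def IsTrace (Ω e : Set (E d)) (B : (E d → ℝ) → E d → ℝ) (ψ : E d → ℝ) (g : e → ℝ) : Prop :=
  MemLp g 2 (surfOn e) ∧ ∀ φ : ℕ → E d → ℝ, Approx Ω φ ψ →
    Tendsto (fun n => ∫ x : e, (B (φ n) x - g x) ^ 2 ∂(surfOn e)) atTop (𝓝 0)

open scoped Classical in
/-- The trace on `e` of `B ψ`. -/
def trace (Ω e : Set (E d)) (B : (E d → ℝ) → E d → ℝ) (ψ : E d → ℝ) : e → ℝ :=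
  if h : ∃ g, IsTrace Ω e B ψ g then h.choose else 0

/-- `Q_h ψ = (Q_0 ψ, Q_b ψ, Q_n (∇ψ · n_e))`. -/
def Qh (M : PolytopalMesh d Ω) (k : ℕ) (ψ : E d → ℝ) : Vh M k :=
  (fun T => l2proj (volOn T.1) (polyOn k T.1) (fun x => ψ x),
   fun e => l2proj (surfOn e.1) (polyOn k e.1) (trace Ω e.1 (fun φ => φ) ψ),
   fun e => l2proj (surfOn e.1) (polyOn (k - 1) e.1)
     (trace Ω e.1 (fun φ x => fderiv ℝ φ x (M.normal e.1)) ψ))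

/-! ### The semi-discrete scheme -/

/-- `w` is the continuous representative of an element of `H¹(0, t̄; V)`, with derivative `w'`,
where `V` is a finite-dimensional space: `w' ∈ L²(0, t̄; V)` and `w(t) = w(0) + ∫_0^t w'`. -/
def IsH1 {V : Type*} [AddCommGroup V] [Module ℝ V] (tbar : ℝ) (w w' : ℝ → V) : Prop :=
  ∀ l : Module.Dual ℝ V,
    MemLp (fun t => l (w' t)) 2 (volume.restrict (Ioc 0 tbar)) ∧
      ∀ t ∈ Icc 0 tbar, l (w t) = l (w 0) + ∫ s in (0 : ℝ)..t, l (w' s)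

/-- `w ∈ H¹(0, t̄; V_h^0)` (continuous representative, with derivative `w'`) satisfies
`(w_t, v_0) + (Δ_w w, Δ_w v) = (f, v_0)` for all `v ∈ V_h^0`, for almost every `t`. -/
def SolvesScheme (M : PolytopalMesh d Ω) (k j : ℕ) (tbar : ℝ) (f : ℝ → E d → ℝ)
    (w w' : ℝ → Vh0 M k) : Prop :=
  IsH1 tbar w w' ∧
    ∀ᵐ t ∂(volume.restrict (Ioc 0 tbar)), ∀ v : Vh0 M k,
      ip0 M (w' t).1.1 v.1.1 + aw M j (w t).1 v.1 = load M (f t) v.1.1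

/-- `u : [0, t̄] → V_h^0` is a solution of the semi-discrete scheme with `u(0) = Q_h ψ`. On
`(0, t̄]` it is (the continuous representative of) an element of `H¹(0, t̄; V_h^0)` that solves
the equation; the component `u_0`, the only one that is differentiated in time in the scheme, is
continuous also at `t = 0`. -/
def IsSemidiscreteSolution (M : PolytopalMesh d Ω) (k j : ℕ) (tbar : ℝ) (f : ℝ → E d → ℝ)
    (ψ : E d → ℝ) (u : ℝ → Vh0 M k) : Prop :=
  (u 0).1 = Qh M k ψ ∧
    ∃ w w' : ℝ → Vh0 M k, SolvesScheme M k j tbar f w w' ∧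
      (∀ t ∈ Ioc 0 tbar, u t = w t) ∧ (u 0).1.1 = (w 0).1.1

/-- `f ∈ L²(0, t̄; L²(Ω))`. -/
def IsSource (Ω : Set (E d)) (tbar : ℝ) (f : ℝ → E d → ℝ) : Prop :=
  MemLp (fun z : ℝ × E d => f z.1 z.2) 2
    ((volume.restrict (Ioc 0 tbar)).prod (volume.restrict Ω))

/-! ### The matrix form -/

/-- The Gram matrix with entries `(Δ_w y_j, Δ_w x_i)`. -/
def stiff {α β : Type*} (M : PolytopalMesh d Ω) (j : ℕ) (x : α → Vh M k) (y : β → Vh M k) :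
    Matrix α β ℝ :=
  Matrix.of fun a b => aw M j (y b) (x a)

/-- The mass matrix `C` with entries `(φ_j, φ_i)`. -/
def mass {ι : Type*} (M : PolytopalMesh d Ω) (φ : ι → ∀ T : M.elems, polyOn k T.1) :
    Matrix ι ι ℝ :=
  Matrix.of fun a b => ip0 M (φ b) (φ a)

/-- The weak functions `{φ_i, 0, 0}`. -/
def intVec {ι : Type*} {M : PolytopalMesh d Ω} (φ : ι → ∀ T : M.elems, polyOn k T.1) (i : ι) :
    Vh M k :=
  (φ i, 0, 0)

/-- The weak functions `{0, ψ_i, 0}` followed by the `{0, 0, ς_i}`. With this family `x` of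
boundary functions, `stiff M j x x` is the block matrix `[A_bb A_bg; A_gb A_gg]`. -/
def bdryVec {κ ρ : Type*} {M : PolytopalMesh d Ω} (χ : κ → faceSpace M k)
    (ς : ρ → faceSpace M (k - 1)) : κ ⊕ ρ → Vh M k :=
  Sum.elim (fun i => (0, (χ i).1, 0)) (fun i => (0, 0, (ς i).1))

/-- The reduced system: the coefficients `b` of the interior component solve the linear system
of ordinary differential equations
`b' = C⁻¹ F + C⁻¹ ([A_0b A_0g] [A_bb A_bg; A_gb A_gg]⁻¹ [A_b0; A_g0] - A_00) b`, with `b(0)` the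
coefficients of `Q_0 ψ`, and the coefficients of the edge/face components at times `t > 0` are
`-[A_bb A_bg; A_gb A_gg]⁻¹ [A_b0; A_g0] b(t)`. -/
def SolvesReduced {ι κ ρ : Type*} [Fintype ι] [DecidableEq ι] [Fintype κ] [DecidableEq κ]
    [Fintype ρ] [DecidableEq ρ] (M : PolytopalMesh d Ω) (k j : ℕ)
    (φ : Module.Basis ι ℝ (∀ T : M.elems, polyOn k T.1))
    (χ : Module.Basis κ ℝ (faceSpace M k)) (ς : Module.Basis ρ ℝ (faceSpace M (k - 1)))
    (tbar : ℝ) (f : ℝ → E d → ℝ) (ψ : E d → ℝ) (u : ℝ → Vh0 M k) : Prop :=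
  let x := intVec φ
  let y := bdryVec χ ς
  (u 0).1 = Qh M k ψ ∧
    ∃ b b' : ℝ → ι → ℝ, IsH1 tbar b b' ∧ (∀ i, b 0 i = φ.repr (Qh M k ψ).1 i) ∧
      (∀ᵐ t ∂(volume.restrict (Ioc 0 tbar)),
        b' t = (mass M φ)⁻¹.mulVec (fun i => load M (f t) (φ i)) +
          (mass M φ)⁻¹.mulVec
            ((stiff M j x y * (stiff M j y y)⁻¹ * stiff M j y x - stiff M j x x).mulVec (b t))) ∧
      ∀ t ∈ Ioc 0 tbar,
        (u t).1 = ∑ i, b t i • x i +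
          ∑ i, (-((stiff M j y y)⁻¹ * stiff M j y x)).mulVec (b t) i • y i

end SFWG

end

/-!
The proof separates the finite-dimensional algebra of the scheme from the geometry of the mesh.

*Geometry.* Elements and faces are compact, and their measures are finite and positive on nonempty
relatively open sets; for a face this follows from an isometric parametrization of its affine span,
which carries the surface measure to Lebesgue measure. Hence `L²` inner products of polynomials are
definite: the mass form is definite, the weak Laplacian exists by the Riesz representation on
`P_j(T)`, is unique and depends linearly on the weak function, and a weak function of zero energy
has vanishing weak Laplacian and is orthogonal to all others. Since test functions vanish near
`∂Ω`, the traces of an `H²_0` function on boundary faces vanish, so `Q_h ψ ∈ V_h^0` (`Qh_mem`).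

*Every degree.* The equations for the boundary components have a symmetric, possibly singular
matrix, but their right-hand side annihilates its kernel, so the boundary components can be chosen
as a linear function of the interior one (`exists_boundary_lift`). What remains is a linear system
of ordinary differential equations with square integrable data. The initial value `Q_h ψ` is
attained in all components exactly if it satisfies the equations without time derivative, which
persist up to `t = 0` by continuity (`exists_continuous_iff`).

*Large degree.* The boundary data `(v_b, v_n)` for which the weak Laplacian of degree `j` vanishes
form a decreasing sequence of subspaces of a finite-dimensional space, so it suffices that no
nonzero boundary data annihilate all polynomials (`boundary_eq_zero_of_weakRhs`). Multiply the test
functions by the squares of the affine functions of the planes of the faces of `T` other than that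
of a given face `e`. Then only faces in the plane of `e` contribute, and, by the density of the
polynomials in the continuous functions, a weight that vanishes on the other faces in that plane
isolates `e`. One further factor, the affine function of `e` itself, turns the normal derivative
of the test function into a value, which gives `v_b = 0`; then `v_n = 0` follows. So
`stiff M j y y` is invertible for `j ≥ j₀`, block elimination gives the reduced system
(`isSemidiscreteSolution_iff`), and uniqueness is that for a linear system of ordinary differential
equations.
-/

open MeasureTheory Filter Topology Set
open scoped ContDiff

noncomputable section

namespace SFWG
variable {d : ℕ} {Ω : Set (E d)}

/-! ### Measures on elements and faces -/

theorem IsPolytope.isCompact {S : Set (E d)} (hS : IsPolytope S) : IsCompact S := by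
  obtain ⟨F, hF, hfin, rfl⟩ := hS
  exact hF.isCompact_biUnion fun s hs => (hfin s hs).isCompact_convexHull ℝ

theorem IsPolytope.volume_frontier {S : Set (E d)} (hS : IsPolytope S) :
    volume (frontier S) = 0 := by
  obtain ⟨F, hF, hfin, rfl⟩ := hS
  have hcl : ∀ s ∈ F, IsClosed (convexHull ℝ s) := fun s hs =>
    (hfin s hs).isClosed_convexHull ℝ
  -- a frontier point of the finite union is a frontier point of one of the convex hulls
  have hsub : frontier (⋃ s ∈ F, convexHull ℝ s) ⊆ ⋃ s ∈ F, frontier (convexHull ℝ s) := by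
    intro x hx
    rw [(hF.isClosed_biUnion hcl).frontier_eq] at hx
    obtain ⟨s, hs, hxs⟩ := mem_iUnion₂.1 hx.1
    refine mem_iUnion₂.2 ⟨s, hs, ?_⟩
    rw [(hcl s hs).frontier_eq]
    exact ⟨hxs, fun h => hx.2 (interior_mono
      (subset_biUnion_of_mem (u := fun s => convexHull ℝ s) hs) h)⟩
  exact measure_mono_null hsub ((measure_biUnion_null_iff hF.countable).2 fun s _ =>
    (convex_convexHull ℝ s).addHaar_frontier volume)

/-- It suffices to test positivity on the open sets that meet a dense part `I` of `D`, the
(intrinsic) interior in the applications. -/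
theorem comap_coe_open_pos {D : Set (E d)} (hD : MeasurableSet D) {μ : Measure (E d)}
    {I : Set (E d)} (hID : D ⊆ closure I)
    (hpos : ∀ U : Set (E d), IsOpen U → (U ∩ I).Nonempty → μ (U ∩ D) ≠ 0) :
    (μ.comap (Subtype.val : D → E d)).IsOpenPosMeasure := by
  refine ⟨fun W hW hne => ?_⟩
  obtain ⟨U, hU, rfl⟩ := isOpen_induced_iff.1 hW
  obtain ⟨x, hx⟩ := hne
  rw [comap_subtype_coe_apply hD, Subtype.image_preimage_coe, inter_comm]
  exact hpos U hU (mem_closure_iff.1 (hID x.2) U hU hx)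

theorem comap_coe_finite {D : Set (E d)} (hD : MeasurableSet D) {μ : Measure (E d)}
    (h : μ D < ⊤) : IsFiniteMeasure (μ.comap (Subtype.val : D → E d)) := by
  refine ⟨?_⟩
  rw [comap_subtype_coe_apply hD, image_univ, Subtype.range_coe]
  exact h

/-- An isometric parametrization of the affine span of `e` by its direction, in which the intrinsic
interior of `e` is open. -/
theorem exists_isometry_affineSpan {e : Set (E d)} {p : E d} (hp : p ∈ e) :
    ∃ A : (affineSpan ℝ e).direction → E d, Isometry A ∧ (∀ v, A v = (v : E d) + p) ∧
      range A = affineSpan ℝ e ∧ IsOpen (A ⁻¹' intrinsicInterior ℝ e) := by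
  have hp' : p ∈ affineSpan ℝ e := subset_affineSpan ℝ e hp
  have : Nonempty (affineSpan ℝ e) := ⟨⟨p, hp'⟩⟩
  let B := IsometryEquiv.vaddConst (⟨p, hp'⟩ : affineSpan ℝ e)
  refine ⟨Subtype.val ∘ B, isometry_subtype_coe.comp B.isometry, fun v => rfl, ?_, ?_⟩
  · rw [range_comp, B.surjective.range_eq, image_univ, Subtype.range_coe]
  · rw [preimage_comp, intrinsicInterior, preimage_image_eq _ Subtype.val_injective]
    exact isOpen_interior.preimage B.continuous

namespace PolytopalMesh
variable (M : PolytopalMesh d Ω)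

theorem elem_isCompact (T : M.elems) : IsCompact T.1 := (M.elem_polytope T.1 T.2).isCompact
theorem face_isCompact (e : M.faces) : IsCompact e.1 := (M.face_polytope e.1 e.2).isCompact

instance (T : M.elems) : CompactSpace T.1 := isCompact_iff_compactSpace.1 (M.elem_isCompact T)
instance (e : M.faces) : CompactSpace e.1 := isCompact_iff_compactSpace.1 (M.face_isCompact e)

instance (T : M.elems) : IsFiniteMeasure (volOn T.1) :=
  comap_coe_finite (M.elem_isCompact T).measurableSet (M.elem_isCompact T).measure_lt_top

instance (T : M.elems) : (volOn T.1).IsOpenPosMeasure := by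
  refine comap_coe_open_pos (M.elem_isCompact T).measurableSet (M.elem_regular T.1 T.2).ge ?_
  intro U hU hne h0
  exact ((hU.inter isOpen_interior).measure_pos volume hne).ne'
    (measure_mono_null (inter_subset_inter_right U interior_subset) h0)

/-- In isometric coordinates the surface measure of a face is Lebesgue measure. -/
theorem surf_image {e : Set (E d)} (he : e ∈ M.faces)
    {A : (affineSpan ℝ e).direction → E d} (hA : Isometry A)
    (S : Set (affineSpan ℝ e).direction) :
    (Measure.euclideanHausdorffMeasure (d - 1) : Measure (E d)) (A '' S) = volume S := by
  have hd : d - 1 = Module.finrank ℝ (affineSpan ℝ e).direction := by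
    have := M.face_dim e he
    omega
  rw [hA.euclideanHausdorffMeasure_image, hd, InnerProductSpace.euclideanHausdorffMeasure_eq_volume]

theorem face_nonempty (e : M.faces) : (intrinsicInterior ℝ e.1).Nonempty :=
  (M.face_connected e.1 e.2).nonempty

instance (e : M.faces) : IsFiniteMeasure (surfOn e.1) := by
  obtain ⟨p, hp⟩ := M.face_nonempty e
  obtain ⟨A, hA, -, hr, -⟩ := exists_isometry_affineSpan (intrinsicInterior_subset hp)
  refine comap_coe_finite (M.face_isCompact e).measurableSet ?_
  have : e.1 = A '' (A ⁻¹' e.1) := by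
    rw [image_preimage_eq_inter_range, hr, inter_eq_left.2 (subset_affineSpan ℝ e.1)]
  rw [this, M.surf_image e.2 hA]
  exact (hA.isClosedEmbedding.isCompact_preimage (M.face_isCompact e)).measure_lt_top

instance (e : M.faces) : (surfOn e.1).IsOpenPosMeasure := by
  obtain ⟨p, hp⟩ := M.face_nonempty e
  obtain ⟨A, hA, -, hr, ho⟩ := exists_isometry_affineSpan (intrinsicInterior_subset hp)
  refine comap_coe_open_pos (M.face_isCompact e).measurableSet (M.face_regular e.1 e.2).ge ?_
  rintro U hU ⟨x, hxU, hx⟩ h0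
  obtain ⟨v, rfl⟩ : x ∈ range A := hr ▸ subset_affineSpan ℝ e.1 (intrinsicInterior_subset hx)
  have h1 : (Measure.euclideanHausdorffMeasure (d - 1) : Measure (E d))
      (A '' (A ⁻¹' U ∩ A ⁻¹' intrinsicInterior ℝ e.1)) = 0 := by
    refine measure_mono_null ?_ h0
    rintro _ ⟨w, ⟨hw, hw'⟩, rfl⟩
    exact ⟨hw, intrinsicInterior_subset hw'⟩
  rw [M.surf_image e.2 hA] at h1
  exact (((hU.preimage hA.continuous).inter ho).measure_pos volume ⟨v, hxU, hx⟩).ne' h1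

/-- Elements lie in `Ω` up to a null set, so that functions on `Ω` can be integrated over them. -/
theorem restrict_elem_le (T : M.elems) :
    (volume : Measure (E d)).restrict T.1 ≤ volume.restrict Ω := by
  have h : (interior T.1 : Set (E d)) =ᵐ[volume] T.1 :=
    interior_ae_eq_of_null_frontier (M.elem_polytope T.1 T.2).volume_frontier
  rw [← Measure.restrict_congr_set h]
  exact Measure.restrict_mono (M.elem_subset T.1 T.2) le_rfl

end PolytopalMesh

/-! ### Continuous functions on compact sets and polynomials -/

theorem continuous_peval (p : MvPolynomial (Fin d) ℝ) : Continuous (peval p) :=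
  (MvPolynomial.continuous_eval p).comp (by fun_prop : Continuous fun x : E d => fun i => x i)

theorem continuous_of_mem_polyOn {m : ℕ} {D : Set (E d)} (p : polyOn m D) : Continuous p.1 := by
  obtain ⟨q, -, hq⟩ := p.2
  rw [← hq]
  exact (continuous_peval q).comp continuous_subtype_val

theorem integrable_of_continuous {D : Set (E d)} [CompactSpace D] {μ : Measure D}
    [IsFiniteMeasure μ] {g : D → ℝ} (hg : Continuous g) : Integrable g μ :=
  hg.integrable_of_hasCompactSupport (HasCompactSupport.of_compactSpace g)

theorem eq_zero_of_integral_eq_zero {D : Set (E d)} [CompactSpace D] {μ : Measure D}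
    [IsFiniteMeasure μ] [μ.IsOpenPosMeasure] {g : D → ℝ} (hg : Continuous g) (h0 : ∀ x, 0 ≤ g x)
    (h : ∫ x, g x ∂μ = 0) : g = 0 := by
  rw [integral_eq_zero_iff_of_nonneg h0 (integrable_of_continuous hg)] at h
  exact (hg.ae_eq_iff_eq μ continuous_const).1 h

theorem eq_zero_of_integral_mul_self {D : Set (E d)} [CompactSpace D] {μ : Measure D}
    [IsFiniteMeasure μ] [μ.IsOpenPosMeasure] {g : D → ℝ} (hg : Continuous g)
    (h : ∫ x, g x * g x ∂μ = 0) : g = 0 := by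
  have := eq_zero_of_integral_eq_zero (hg.mul hg) (fun x => mul_self_nonneg _) h
  ext x
  simpa using congrFun this x

theorem peval_add (p q : MvPolynomial (Fin d) ℝ) (x : E d) :
    peval (p + q) x = peval p x + peval q x := by simp [peval]
theorem peval_smul (c : ℝ) (p : MvPolynomial (Fin d) ℝ) (x : E d) :
    peval (c • p) x = c * peval p x := by simp [peval]
theorem peval_mul (p q : MvPolynomial (Fin d) ℝ) (x : E d) :
    peval (p * q) x = peval p x * peval q x := by simp [peval]
theorem peval_zero (x : E d) : peval (0 : MvPolynomial (Fin d) ℝ) x = 0 := by simp [peval]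

theorem analyticOnNhd_peval (p : MvPolynomial (Fin d) ℝ) : AnalyticOnNhd ℝ (peval p) univ := by
  have h := AnalyticOnNhd.eval_mvPolynomial (𝕜 := ℝ) p
  exact h.comp (g := fun x => MvPolynomial.eval x p) (f := fun x : E d => fun i => x i)
    (fun x _ => (EuclideanSpace.equiv (Fin d) ℝ).toContinuousLinearMap.analyticAt x)
    (fun _ _ => mem_univ _)

theorem eq_zero_of_peval_eq_zero_on_open {p : MvPolynomial (Fin d) ℝ} {U : Set (E d)}
    (hU : IsOpen U) (hne : U.Nonempty) (h : ∀ x ∈ U, peval p x = 0) : p = 0 := by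
  obtain ⟨x, hx⟩ := hne
  have h1 : peval p = 0 := (analyticOnNhd_peval p).eq_of_eventuallyEq (analyticOnNhd_const (v := 0))
    (z₀ := x) (Filter.eventually_of_mem (hU.mem_nhds hx) h)
  refine MvPolynomial.funext fun y => ?_
  simpa [peval] using congrFun h1 (WithLp.toLp 2 y)

variable {k : ℕ}

/-! ### The weak Laplacian as a linear map -/

theorem plaplace_add (p q : MvPolynomial (Fin d) ℝ) :
    plaplace (p + q) = plaplace p + plaplace q := by
  simp [plaplace, Finset.sum_add_distrib]
theorem plaplace_smul (c : ℝ) (p : MvPolynomial (Fin d) ℝ) :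
    plaplace (c • p) = c • plaplace p := by
  simp [plaplace, Finset.smul_sum]
theorem pnormal_add (p q : MvPolynomial (Fin d) ℝ) (n x : E d) :
    pnormal (p + q) n x = pnormal p n x + pnormal q n x := by
  simp [pnormal, peval_add, add_mul, Finset.sum_add_distrib]
theorem pnormal_smul (c : ℝ) (p : MvPolynomial (Fin d) ℝ) (n x : E d) :
    pnormal (c • p) n x = c * pnormal p n x := by
  simp [pnormal, peval_smul, mul_assoc, Finset.mul_sum]
theorem pnormal_mul (p q : MvPolynomial (Fin d) ℝ) (n x : E d) :
    pnormal (p * q) n x = pnormal p n x * peval q x + peval p x * pnormal q n x := by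
  simp only [pnormal, Derivation.leibniz, smul_eq_mul, peval_add, peval_mul, Finset.sum_mul,
    Finset.mul_sum, ← Finset.sum_add_distrib]
  refine Finset.sum_congr rfl fun i _ => ?_
  ring
theorem continuous_pnormal (p : MvPolynomial (Fin d) ℝ) (n : E d) : Continuous (pnormal p n) := by
  unfold pnormal
  exact continuous_finsetSum _ fun i _ => (continuous_peval _).mul continuous_const

/-- The functional of `φ` that defines the weak Laplacian of `v` on `T`. -/
def weakRhs (M : PolytopalMesh d Ω) (v : Vh M k) (T : M.elems) (φ : MvPolynomial (Fin d) ℝ) : ℝ :=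
  ∫ x, (v.1 T).1 x * peval (plaplace φ) x ∂(volOn T.1)
    - ∑ e ∈ M.facesOf T.1,
        ∫ x, (v.2.1 e).1 x * pnormal φ (M.outNormal T.1 e.1) x ∂(surfOn e.1)
    + ∑ e ∈ M.facesOf T.1,
        ∫ x, (v.2.2 e).1 x * inner ℝ (M.normal e.1) (M.outNormal T.1 e.1) * peval φ x
          ∂(surfOn e.1)

variable (M : PolytopalMesh d Ω)

section
variable {D : Set (E d)} [CompactSpace D] {μ : Measure D} [IsFiniteMeasure μ] {a b c : D → ℝ}

theorem integral_add_mul (ha : Continuous a) (hb : Continuous b) (hc : Continuous c) :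
    ∫ x, (a x + b x) * c x ∂μ = ∫ x, a x * c x ∂μ + ∫ x, b x * c x ∂μ := by
  simp only [add_mul]
  exact integral_add (f := fun x => a x * c x) (g := fun x => b x * c x)
    (integrable_of_continuous (ha.mul hc)) (integrable_of_continuous (hb.mul hc))

theorem integral_mul_add (ha : Continuous a) (hb : Continuous b) (hc : Continuous c) :
    ∫ x, c x * (a x + b x) ∂μ = ∫ x, c x * a x ∂μ + ∫ x, c x * b x ∂μ := by
  simpa only [mul_comm (c _)] using integral_add_mul ha hb hc

end

theorem integral_smul_mul {D : Set (E d)} {μ : Measure D} (r : ℝ) (a b : D → ℝ) :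
    ∫ x, r * a x * b x ∂μ = r * ∫ x, a x * b x ∂μ := by
  simp only [mul_assoc, integral_const_mul]

theorem integral_mul_smul {D : Set (E d)} {μ : Measure D} (r : ℝ) (a b : D → ℝ) :
    ∫ x, a x * (r * b x) ∂μ = r * ∫ x, a x * b x ∂μ := by
  simp only [mul_left_comm _ r, integral_const_mul]

theorem continuous_peval_coe (p : MvPolynomial (Fin d) ℝ) (D : Set (E d)) :
    Continuous fun x : D => peval p x := (continuous_peval p).comp continuous_subtype_val
theorem continuous_pnormal_coe (p : MvPolynomial (Fin d) ℝ) (n : E d) (D : Set (E d)) :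
    Continuous fun x : D => pnormal p n x := (continuous_pnormal p n).comp continuous_subtype_val

variable {M} in
theorem weakRhs_add_right (v : Vh M k) (T : M.elems) (φ ψ : MvPolynomial (Fin d) ℝ) :
    weakRhs M v T (φ + ψ) = weakRhs M v T φ + weakRhs M v T ψ := by
  unfold weakRhs
  simp only [plaplace_add, pnormal_add, peval_add]
  rw [integral_mul_add (continuous_peval_coe _ _) (continuous_peval_coe _ _)
      (continuous_of_mem_polyOn _),
    Finset.sum_congr rfl fun e _ => integral_mul_add (continuous_pnormal_coe _ _ _)
      (continuous_pnormal_coe _ _ _) (continuous_of_mem_polyOn (v.2.1 e)),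
    Finset.sum_congr rfl fun e _ => integral_mul_add
      (c := fun x => (v.2.2 e).1 x * inner ℝ (M.normal e.1) (M.outNormal T.1 e.1))
      (continuous_peval_coe φ _) (continuous_peval_coe ψ _)
      ((continuous_of_mem_polyOn (v.2.2 e)).mul continuous_const),
    Finset.sum_add_distrib, Finset.sum_add_distrib]
  ring

variable {M} in
theorem weakRhs_smul_right (v : Vh M k) (T : M.elems) (r : ℝ) (φ : MvPolynomial (Fin d) ℝ) :
    weakRhs M v T (r • φ) = r * weakRhs M v T φ := by
  unfold weakRhs
  simp only [plaplace_smul, pnormal_smul, peval_smul, integral_mul_smul, ← Finset.mul_sum]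
  ring

variable {M} in
theorem weakRhs_add_left (v w : Vh M k) (T : M.elems) (φ : MvPolynomial (Fin d) ℝ) :
    weakRhs M (v + w) T φ = weakRhs M v T φ + weakRhs M w T φ := by
  unfold weakRhs
  simp only [Prod.fst_add, Prod.snd_add, Pi.add_apply, Submodule.coe_add, mul_assoc]
  rw [integral_add_mul (continuous_of_mem_polyOn _) (continuous_of_mem_polyOn _)
      (continuous_peval_coe _ _),
    Finset.sum_congr rfl fun e _ => integral_add_mul (continuous_of_mem_polyOn (v.2.1 e))
      (continuous_of_mem_polyOn (w.2.1 e)) (continuous_pnormal_coe _ _ _),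
    Finset.sum_congr rfl fun e _ => integral_add_mul
      (c := fun x => inner ℝ (M.normal e.1) (M.outNormal T.1 e.1) * peval φ x)
      (continuous_of_mem_polyOn (v.2.2 e)) (continuous_of_mem_polyOn (w.2.2 e))
      (continuous_const.mul (continuous_peval_coe φ _)),
    Finset.sum_add_distrib, Finset.sum_add_distrib]
  ring

variable {M} in
theorem weakRhs_smul_left (r : ℝ) (v : Vh M k) (T : M.elems) (φ : MvPolynomial (Fin d) ℝ) :
    weakRhs M (r • v) T φ = r * weakRhs M v T φ := by
  unfold weakRhs
  simp only [Prod.smul_fst, Prod.smul_snd, Pi.smul_apply, Submodule.coe_smul, smul_eq_mul,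
    mul_assoc, ← Finset.mul_sum, integral_const_mul]
  ring

/-- The `L²(T)` inner product on `P_j(T)`, as a map into the dual space. -/
def polyForm (T : M.elems) (j : ℕ) : MvPolynomial.restrictTotalDegree (Fin d) ℝ j →ₗ[ℝ]
    Module.Dual ℝ (MvPolynomial.restrictTotalDegree (Fin d) ℝ j) :=
  LinearMap.mk₂ ℝ (fun p q => ∫ x, peval p.1 x * peval q.1 x ∂(volOn T.1))
    (fun p q r => by
      simp only [Submodule.coe_add, peval_add]
      exact integral_add_mul (continuous_peval_coe _ _) (continuous_peval_coe _ _)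
        (continuous_peval_coe _ _))
    (fun c p q => by simp only [Submodule.coe_smul, peval_smul, integral_smul_mul, smul_eq_mul])
    (fun p q r => by
      simp only [Submodule.coe_add, peval_add]
      exact integral_mul_add (continuous_peval_coe _ _) (continuous_peval_coe _ _)
        (continuous_peval_coe _ _))
    (fun c p q => by simp only [Submodule.coe_smul, peval_smul, integral_mul_smul, smul_eq_mul])

variable {M} in
theorem interior_elem_nonempty (T : M.elems) : (interior T.1).Nonempty :=
  (M.elem_connected T.1 T.2).nonempty

variable {M} in
theorem eq_zero_of_integral_peval_mul_self (T : M.elems) (p : MvPolynomial (Fin d) ℝ)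
    (h : ∫ x, peval p x * peval p x ∂(volOn T.1) = 0) : p = 0 := by
  have h0 := eq_zero_of_integral_mul_self (continuous_peval_coe p T.1) h
  exact eq_zero_of_peval_eq_zero_on_open isOpen_interior (interior_elem_nonempty T)
    fun x hx => congrFun h0 ⟨x, interior_subset hx⟩

theorem polyForm_injective (T : M.elems) (j : ℕ) : Function.Injective (polyForm M T j) := by
  rw [injective_iff_map_eq_zero]
  intro p hp
  exact Subtype.ext (eq_zero_of_integral_peval_mul_self T p.1 (LinearMap.congr_fun hp p))

variable {M}

theorem exists_isWeakLaplacian (j : ℕ) (v : Vh M k) (T : M.elems) :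
    ∃ p, IsWeakLaplacian M j v T p := by
  let F : Module.Dual ℝ (MvPolynomial.restrictTotalDegree (Fin d) ℝ j) :=
    { toFun := fun φ => weakRhs M v T φ.1
      map_add' := fun φ ψ => weakRhs_add_right v T φ.1 ψ.1
      map_smul' := fun r φ => weakRhs_smul_right v T r φ.1 }
  obtain ⟨p, hp⟩ := (LinearMap.injective_iff_surjective_of_finrank_eq_finrank
    (Subspace.dual_finrank_eq).symm).1 (polyForm_injective M T j) F
  exact ⟨p.1, p.2, fun φ hφ => LinearMap.congr_fun hp ⟨φ, hφ⟩⟩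

theorem isWeakLaplacian_weakLaplacian (j : ℕ) (v : Vh M k) (T : M.elems) :
    IsWeakLaplacian M j v T (weakLaplacian M j v T) := by
  rw [weakLaplacian, dif_pos (exists_isWeakLaplacian j v T)]
  exact (exists_isWeakLaplacian j v T).choose_spec

theorem IsWeakLaplacian.eq {j : ℕ} {v : Vh M k} {T : M.elems} {p : MvPolynomial (Fin d) ℝ}
    (h : IsWeakLaplacian M j v T p) : weakLaplacian M j v T = p := by
  have h' := isWeakLaplacian_weakLaplacian j v T
  have := @polyForm_injective _ _ M T j ⟨_, h'.1⟩ ⟨p, h.1⟩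
    (LinearMap.ext fun φ => (h'.2 φ.1 φ.2).trans (h.2 φ.1 φ.2).symm)
  exact congrArg Subtype.val this

theorem weakLaplacian_add (j : ℕ) (v w : Vh M k) (T : M.elems) :
    weakLaplacian M j (v + w) T = weakLaplacian M j v T + weakLaplacian M j w T := by
  have hv := isWeakLaplacian_weakLaplacian j v T
  have hw := isWeakLaplacian_weakLaplacian j w T
  refine IsWeakLaplacian.eq ⟨Submodule.add_mem _ hv.1 hw.1, fun φ hφ => ?_⟩
  simp only [peval_add]
  rw [integral_add_mul (continuous_peval_coe _ _) (continuous_peval_coe _ _)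
    (continuous_peval_coe _ _), hv.2 φ hφ, hw.2 φ hφ]
  exact (weakRhs_add_left v w T φ).symm

theorem weakLaplacian_smul (j : ℕ) (r : ℝ) (v : Vh M k) (T : M.elems) :
    weakLaplacian M j (r • v) T = r • weakLaplacian M j v T := by
  have hv := isWeakLaplacian_weakLaplacian j v T
  refine IsWeakLaplacian.eq ⟨Submodule.smul_mem _ r hv.1, fun φ hφ => ?_⟩
  simp only [peval_smul, integral_smul_mul]
  rw [hv.2 φ hφ]
  exact (weakRhs_smul_left r v T φ).symm

theorem weakRhs_eq_zero_of_weakLaplacian_eq_zero {j : ℕ} {v : Vh M k} {T : M.elems}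
    (h : weakLaplacian M j v T = 0) {φ : MvPolynomial (Fin d) ℝ}
    (hφ : φ ∈ MvPolynomial.restrictTotalDegree (Fin d) ℝ j) : weakRhs M v T φ = 0 := by
  have := (isWeakLaplacian_weakLaplacian j v T).2 φ hφ
  simp only [h, peval_zero, zero_mul, integral_zero] at this
  exact this.symm

/-! ### The bilinear forms of the scheme -/

theorem aw_comm (j : ℕ) (u v : Vh M k) : aw M j u v = aw M j v u := by
  simp only [aw, mul_comm]

theorem aw_add_left (j : ℕ) (u v w : Vh M k) : aw M j (u + v) w = aw M j u w + aw M j v w := by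
  simp only [aw, weakLaplacian_add, peval_add, ← Finset.sum_add_distrib]
  exact Finset.sum_congr rfl fun T _ => integral_add_mul (continuous_peval_coe _ _)
    (continuous_peval_coe _ _) (continuous_peval_coe _ _)

theorem aw_smul_left (j : ℕ) (r : ℝ) (u v : Vh M k) : aw M j (r • u) v = r * aw M j u v := by
  simp only [aw, weakLaplacian_smul, peval_smul, integral_smul_mul, Finset.mul_sum]

variable (M k) in
/-- `(Δ_w u, Δ_w v)` as a bilinear form. -/
def awForm (j : ℕ) : LinearMap.BilinForm ℝ (Vh M k) :=
  LinearMap.mk₂ ℝ (aw M j) (aw_add_left j) (aw_smul_left j)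
    (fun u v w => by rw [aw_comm, aw_add_left, aw_comm j v, aw_comm j w])
    (fun r u v => by rw [aw_comm, aw_smul_left, aw_comm j v]; rfl)

@[simp] theorem awForm_apply (j : ℕ) (u v : Vh M k) : awForm k M j u v = aw M j u v := rfl

theorem weakLaplacian_eq_zero_of_aw_self {j : ℕ} {v : Vh M k} (h : aw M j v v = 0)
    (T : M.elems) : weakLaplacian M j v T = 0 := by
  have h0 : ∀ T ∈ Finset.univ, 0 ≤ ∫ x, peval (weakLaplacian M j v T) x *
      peval (weakLaplacian M j v T) x ∂(volOn T.1) :=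
    fun T _ => integral_nonneg fun x => mul_self_nonneg _
  exact eq_zero_of_integral_peval_mul_self T _
    ((Finset.sum_eq_zero_iff_of_nonneg h0).1 h T (Finset.mem_univ T))

/-- A weak function of zero energy is orthogonal to all of `V_h`. -/
theorem aw_eq_zero_of_aw_self {j : ℕ} {v : Vh M k} (h : aw M j v v = 0) (w : Vh M k) :
    aw M j v w = 0 := by
  simp [aw, weakLaplacian_eq_zero_of_aw_self h, peval_zero]

variable (M k) in
/-- `(u_0, v_0)` as a bilinear form. -/
def ipForm : LinearMap.BilinForm ℝ (∀ T : M.elems, polyOn k T.1) :=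
  LinearMap.mk₂ ℝ (ip0 M)
    (fun u v w => by
      simp only [ip0, Pi.add_apply, Submodule.coe_add, ← Finset.sum_add_distrib]
      exact Finset.sum_congr rfl fun T _ => integral_add_mul (continuous_of_mem_polyOn _)
        (continuous_of_mem_polyOn _) (continuous_of_mem_polyOn _))
    (fun r u v => by
      simp only [ip0, Pi.smul_apply, Submodule.coe_smul, smul_eq_mul, integral_smul_mul,
        Finset.mul_sum])
    (fun w u v => by
      simp only [ip0, Pi.add_apply, Submodule.coe_add, ← Finset.sum_add_distrib]
      exact Finset.sum_congr rfl fun T _ => integral_mul_add (continuous_of_mem_polyOn _)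
        (continuous_of_mem_polyOn _) (continuous_of_mem_polyOn _))
    (fun r u v => by
      simp only [ip0, Pi.smul_apply, Submodule.coe_smul, smul_eq_mul, integral_mul_smul,
        Finset.mul_sum])

@[simp] theorem ipForm_apply (u v : ∀ T : M.elems, polyOn k T.1) :
    ipForm k M u v = ip0 M u v := rfl

theorem eq_zero_of_ip0_self {u : ∀ T : M.elems, polyOn k T.1} (h : ip0 M u u = 0) : u = 0 := by
  have h0 : ∀ T ∈ Finset.univ, 0 ≤ ∫ x, (u T).1 x * (u T).1 x ∂(volOn T.1) :=
    fun T _ => integral_nonneg fun x => mul_self_nonneg _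
  ext1 T
  exact Subtype.ext (eq_zero_of_integral_mul_self (continuous_of_mem_polyOn _)
    ((Finset.sum_eq_zero_iff_of_nonneg h0).1 h T (Finset.mem_univ T)))

/-! ### The hyperplanes of the faces -/

theorem pnormal_X_sub_C (i : Fin d) (c : ℝ) (n x : E d) :
    pnormal (MvPolynomial.X i - MvPolynomial.C c) n x = n i := by
  simp [pnormal, MvPolynomial.pderiv_X, Pi.single_apply, peval, apply_ite]

theorem pnormal_C (c : ℝ) (n x : E d) : pnormal (MvPolynomial.C c) n x = 0 := by
  simp [pnormal, peval]

namespace PolytopalMesh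
variable (M)

/-- The affine function `y ↦ n_e · (y - x_e)`, for a point `x_e` of the face `e`, as a
polynomial. -/
def facePoly (e : M.faces) : MvPolynomial (Fin d) ℝ :=
  ∑ i, MvPolynomial.C (M.normal e.1 i) *
    (MvPolynomial.X i - MvPolynomial.C ((M.face_nonempty e).some i))

theorem peval_facePoly (e : M.faces) (y : E d) :
    peval (M.facePoly e) y = inner ℝ (M.normal e.1) (y - (M.face_nonempty e).some) := by
  simp [facePoly, peval, PiLp.inner_apply, mul_comm]

theorem pnormal_facePoly (e : M.faces) (n y : E d) :
    pnormal (M.facePoly e) n y = inner ℝ (M.normal e.1) n := by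
  have h : ∀ s : Finset (Fin d), pnormal (∑ i ∈ s, MvPolynomial.C (M.normal e.1 i) *
      (MvPolynomial.X i - MvPolynomial.C ((M.face_nonempty e).some i))) n y =
        ∑ i ∈ s, M.normal e.1 i * n i := by
    intro s
    induction s using Finset.cons_induction with
    | empty => simp [pnormal, peval]
    | cons i s hi ih =>
      rw [Finset.sum_cons, pnormal_add, ih, pnormal_mul, pnormal_C, pnormal_X_sub_C,
        Finset.sum_cons]
      simp [peval]
  rw [facePoly, h]
  simp [PiLp.inner_apply, mul_comm]

theorem peval_facePoly_of_mem (e : M.faces) {y : E d} (hy : y ∈ e.1) :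
    peval (M.facePoly e) y = 0 := by
  rw [peval_facePoly]
  exact M.normal_orth e.1 e.2 y hy _ (intrinsicInterior_subset (M.face_nonempty e).some_mem)

theorem direction_affineSpan_face (e : M.faces) :
    (affineSpan ℝ e.1).direction = (Submodule.span ℝ {M.normal e.1})ᗮ := by
  have hle : (affineSpan ℝ e.1).direction ≤ (Submodule.span ℝ {M.normal e.1})ᗮ := by
    rw [direction_affineSpan, vectorSpan_def, Submodule.span_le]
    rintro _ ⟨x, hx, y, hy, rfl⟩
    exact Submodule.mem_orthogonal_singleton_iff_inner_right.2 (M.normal_orth e.1 e.2 x hx y hy)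
  refine Submodule.eq_of_le_of_finrank_eq hle ?_
  have h1 := M.face_dim e.1 e.2
  have : Fact (Module.finrank ℝ (E d) = Module.finrank ℝ (affineSpan ℝ e.1).direction + 1) :=
    ⟨by rw [h1]; simp⟩
  have hn : M.normal e.1 ≠ 0 := by
    intro h
    have := M.normal_unit e.1 e.2
    simp [h] at this
  exact (Submodule.finrank_orthogonal_span_singleton hn).symm

theorem mem_affineSpan_face_iff (e : M.faces) (y : E d) :
    y ∈ affineSpan ℝ e.1 ↔ peval (M.facePoly e) y = 0 := by
  have hx := subset_affineSpan ℝ e.1 (intrinsicInterior_subset (M.face_nonempty e).some_mem)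
  rw [peval_facePoly, ← AffineSubspace.vsub_right_mem_direction_iff_mem hx,
    direction_affineSpan_face, Submodule.mem_orthogonal_singleton_iff_inner_right, vsub_eq_sub]

/-- The hyperplane of the face `e'` contains the face `e`. -/
def Coplanar (e e' : M.faces) : Prop := ∀ y ∈ e.1, peval (M.facePoly e') y = 0

variable {M}

theorem Coplanar.affineSpan_eq {e e' : M.faces} (h : M.Coplanar e e') :
    affineSpan ℝ e.1 = affineSpan ℝ e'.1 := by
  have hle : affineSpan ℝ e.1 ≤ affineSpan ℝ e'.1 :=
    affineSpan_le.2 fun y hy => (M.mem_affineSpan_face_iff e' y).2 (h y hy)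
  refine AffineSubspace.eq_of_direction_eq_of_nonempty_of_le ?_
    ⟨_, subset_affineSpan ℝ e.1 (intrinsicInterior_subset (M.face_nonempty e).some_mem)⟩ hle
  refine Submodule.eq_of_le_of_finrank_eq (AffineSubspace.direction_le hle) ?_
  have h1 := M.face_dim e.1 e.2
  have h2 := M.face_dim e'.1 e'.2
  omega

theorem Coplanar.symm {e e' : M.faces} (h : M.Coplanar e e') : M.Coplanar e' e := fun y hy =>
  (M.mem_affineSpan_face_iff e y).1 (h.affineSpan_eq ▸ subset_affineSpan ℝ e'.1 hy)

theorem Coplanar.notMem {e e' : M.faces} (h : M.Coplanar e e') (hne : e ≠ e') {x : E d}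
    (hx : x ∈ intrinsicInterior ℝ e.1) : x ∉ e'.1 := by
  intro hx'
  obtain ⟨z, hz, rfl⟩ := hx
  obtain ⟨U, hU, hUz⟩ := isOpen_induced_iff.1
    (isOpen_interior (s := ((↑) ⁻¹' e.1 : Set (affineSpan ℝ e.1))))
  rw [← M.face_regular e'.1 e'.2] at hx'
  obtain ⟨w, hwU, hw⟩ := mem_closure_iff.1 hx' U hU (by rw [← hUz] at hz; exact hz)
  have hwe : w ∈ affineSpan ℝ e.1 :=
    h.affineSpan_eq ▸ subset_affineSpan ℝ e'.1 (intrinsicInterior_subset hw)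
  refine disjoint_left.1 (M.face_disjoint e.1 e.2 e'.1 e'.2 (fun h => hne (Subtype.ext h))) ?_ hw
  refine ⟨⟨w, hwe⟩, ?_, rfl⟩
  rw [← hUz]
  exact hwU

variable (M)

/-- If the product of two polynomials vanishes in the relative interior of a face, then one of them
vanishes on the face, because polynomials are analytic along the affine span. -/
theorem peval_eq_zero_or_of_mul (e : M.faces) (p q : MvPolynomial (Fin d) ℝ)
    (h : ∀ x ∈ intrinsicInterior ℝ e.1, peval p x * peval q x = 0) :
    (∀ x ∈ e.1, peval p x = 0) ∨ (∀ x ∈ e.1, peval q x = 0) := by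
  by_cases hp : ∀ x ∈ intrinsicInterior ℝ e.1, peval p x = 0
  · left
    intro x hx
    rw [← M.face_regular e.1 e.2] at hx
    exact closure_minimal hp (isClosed_eq (continuous_peval p) continuous_const) hx
  right
  push Not at hp
  obtain ⟨x, hx, hpx⟩ := hp
  obtain ⟨A, hA, hAv, hr, ho⟩ := exists_isometry_affineSpan (intrinsicInterior_subset hx)
  obtain ⟨v, rfl⟩ : x ∈ range A := hr ▸ subset_affineSpan ℝ e.1 (intrinsicInterior_subset hx)
  have hAan : AnalyticOnNhd ℝ A univ := by
    have : A = fun v => (affineSpan ℝ e.1).direction.subtypeL v + A 0 := by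
      ext1 v
      rw [hAv v, hAv 0]
      simp
    rw [this]
    exact ((affineSpan ℝ e.1).direction.subtypeL.analyticOnNhd univ).add analyticOnNhd_const
  have han := (analyticOnNhd_peval q).comp hAan (mapsTo_univ _ _)
  have hq : ∀ᶠ w in 𝓝 v, (peval q ∘ A) w = 0 := by
    filter_upwards [ho.mem_nhds hx,
      ((continuous_peval p).comp hA.continuous).continuousAt.eventually_ne hpx]
      with w hw hw'
    exact (mul_eq_zero.1 (h _ hw)).resolve_left hw'
  have h0 := han.eq_of_eventuallyEq (analyticOnNhd_const (v := 0)) hq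
  intro y hy
  obtain ⟨w, rfl⟩ : y ∈ range A := hr ▸ subset_affineSpan ℝ e.1 hy
  exact congrFun h0 w

theorem peval_eq_zero_of_mul_prod (e : M.faces) (s : Finset M.faces) (p : MvPolynomial (Fin d) ℝ)
    (hs : ∀ e' ∈ s, ¬ M.Coplanar e e')
    (h : ∀ x ∈ intrinsicInterior ℝ e.1, peval p x * peval (∏ e' ∈ s, M.facePoly e') x = 0) :
    ∀ x ∈ e.1, peval p x = 0 := by
  induction s using Finset.cons_induction with
  | empty =>
    intro x hx
    refine (M.peval_eq_zero_or_of_mul e p 1 h).resolve_right (fun h1 => ?_) x hx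
    simpa [peval] using h1 x hx
  | cons i s hi ih =>
    refine ih (fun e' he' => hs e' (Finset.mem_cons_of_mem he')) fun x hx => ?_
    have := (M.peval_eq_zero_or_of_mul e (p * ∏ e' ∈ s, M.facePoly e') (M.facePoly i) (by
      intro x hx
      have := h x hx
      rw [Finset.prod_cons, peval_mul] at this
      rw [peval_mul]
      linarith)).resolve_right (hs i (Finset.mem_cons_self i s))
    rw [← peval_mul]
    exact this x (intrinsicInterior_subset hx)

end PolytopalMesh

/-! ### Polynomials are dense in the continuous functions -/

theorem exists_peval_near {K : Set (E d)} (hK : IsCompact K) {ψ : E d → ℝ} (hψ : Continuous ψ)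
    {ε : ℝ} (hε : 0 < ε) : ∃ p : MvPolynomial (Fin d) ℝ, ∀ x ∈ K, |peval p x - ψ x| < ε := by
  have : CompactSpace K := isCompact_iff_compactSpace.1 hK
  let X : Fin d → C(K, ℝ) := fun i => ⟨fun x => x.1 i, by fun_prop⟩
  let A : Subalgebra ℝ C(K, ℝ) := (MvPolynomial.aeval X).range
  have hsep : A.SeparatesPoints := by
    intro x y hxy
    obtain ⟨i, hi⟩ : ∃ i, x.1 i ≠ y.1 i := by
      by_contra! h
      exact hxy (Subtype.ext (PiLp.ext h))
    exact ⟨X i, ⟨X i, ⟨MvPolynomial.X i, by simp⟩, rfl⟩, hi⟩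
  obtain ⟨⟨_, p, rfl⟩, hp⟩ := ContinuousMap.exists_mem_subalgebra_near_continuous_of_separatesPoints
    A hsep (fun x => ψ x) (hψ.comp continuous_subtype_val) ε hε
  refine ⟨p, fun x hx => ?_⟩
  have hev : (MvPolynomial.aeval X p : C(K, ℝ)) ⟨x, hx⟩ = peval p x := by
    have h := MvPolynomial.comp_aeval_apply (R := ℝ) X
      (ContinuousMap.evalAlgHom ℝ ℝ (⟨x, hx⟩ : K)) p
    exact h.trans (by rw [peval, MvPolynomial.aeval_eq_eval]; rfl)
  rw [← hev]
  exact hp ⟨x, hx⟩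

variable (M)

/-- A finite sum of measures with continuous densities on the faces that annihilates the
polynomials annihilates the continuous functions. -/
theorem sum_integral_eq_zero_of_poly (s : Finset M.faces) (g : ∀ e : M.faces, e.1 → ℝ)
    (hg : ∀ e, Continuous (g e))
    (h : ∀ p : MvPolynomial (Fin d) ℝ, ∑ e ∈ s, ∫ x, g e x * peval p x ∂(surfOn e.1) = 0)
    {ψ : E d → ℝ} (hψ : Continuous ψ) : ∑ e ∈ s, ∫ x, g e x * ψ x ∂(surfOn e.1) = 0 := by
  set C := ∑ e ∈ s, ∫ x, |g e x| ∂(surfOn e.1) with hC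
  have hC0 : 0 ≤ C := Finset.sum_nonneg fun e _ => integral_nonneg fun x => abs_nonneg _
  have hK : IsCompact (⋃ e ∈ s, e.1) := s.isCompact_biUnion fun e _ => M.face_isCompact e
  refine abs_eq_zero.1 (le_antisymm (le_of_forall_pos_le_add fun δ hδ => ?_) (abs_nonneg _))
  obtain ⟨p, hp⟩ := exists_peval_near hK hψ (ε := δ / (C + 1)) (by positivity)
  have hψ' : ∀ e : M.faces, Continuous fun x : e.1 => ψ x :=
    fun e => hψ.comp continuous_subtype_val
  calc |∑ e ∈ s, ∫ x, g e x * ψ x ∂(surfOn e.1)|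
      = |∑ e ∈ s, ∫ x, g e x * (ψ x - peval p x) ∂(surfOn e.1)| := by
        congr 1
        rw [← sub_zero (∑ e ∈ s, ∫ x, g e x * ψ x ∂(surfOn e.1)), ← h p,
          ← Finset.sum_sub_distrib]
        refine Finset.sum_congr rfl fun e _ => ?_
        simp only [mul_sub]
        exact (integral_sub (f := fun x => g e x * ψ x) (g := fun x => g e x * peval p x)
          (integrable_of_continuous ((hg e).mul (hψ' e)))
          (integrable_of_continuous ((hg e).mul (continuous_peval_coe p e.1)))).symm
    _ ≤ ∑ e ∈ s, δ / (C + 1) * ∫ x, |g e x| ∂(surfOn e.1) := by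
        refine (Finset.abs_sum_le_sum_abs _ _).trans (Finset.sum_le_sum fun e he => ?_)
        rw [← integral_const_mul]
        refine (abs_integral_le_integral_abs).trans (integral_mono
          (integrable_of_continuous ((hg e).mul ((hψ' e).sub (continuous_peval_coe p e.1))).abs)
          (integrable_of_continuous (continuous_const.mul (hg e).abs)) fun x => ?_)
        have := hp x (mem_biUnion he x.2)
        simp only [abs_mul]
        rw [abs_sub_comm, mul_comm]
        gcongr
    _ = δ / (C + 1) * C := by rw [← Finset.mul_sum]
    _ ≤ 0 + δ := by
        rw [zero_add, div_mul_eq_mul_div, div_le_iff₀ (by positivity)]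
        nlinarith

/-! ### Unisolvence of the boundary data for weak Laplacians of high degree -/

variable {M}

open scoped Classical in
/-- The product of the affine functions of those faces of `T` that do not lie in the plane
of `e`. -/
def offPlanePoly (M : PolytopalMesh d Ω) (T : M.elems) (e : M.faces) :
    MvPolynomial (Fin d) ℝ :=
  ∏ e' ∈ (M.facesOf T.1).filter (fun e' => ¬ M.Coplanar e e'), M.facePoly e'

theorem peval_offPlanePoly_eq_zero {T : M.elems} {e e' : M.faces} (he' : e' ∈ M.facesOf T.1)
    (h : ¬ M.Coplanar e e') {x : E d} (hx : x ∈ e'.1) : peval (offPlanePoly M T e) x = 0 := by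
  classical
  rw [offPlanePoly, peval, map_prod]
  exact Finset.prod_eq_zero (Finset.mem_filter.2 ⟨he', h⟩) (M.peval_facePoly_of_mem e' hx)

/-- Testing with the squares of `offPlanePoly` isolates the faces in the plane of `e`, and a
continuous weight that vanishes on the other faces in that plane isolates `e` itself. -/
theorem face_component_eq_zero {m : ℕ} {T : M.elems} {e : M.faces} (he : e ∈ M.facesOf T.1)
    (w : ∀ e : M.faces, polyOn m e.1) (c : M.faces → ℝ) (hc : c e ≠ 0)
    (h : ∀ ψ : MvPolynomial (Fin d) ℝ, ∑ e' ∈ M.facesOf T.1,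
      ∫ x, (w e').1 x * c e' * peval (offPlanePoly M T e) x ^ 2 * peval ψ x ∂(surfOn e'.1) = 0) :
    w e = 0 := by
  classical
  obtain ⟨P, -, hP⟩ := (w e).2
  have hPx : ∀ x : e.1, (w e).1 x = peval P x := fun x => by rw [← hP]; rfl
  set S := (M.facesOf T.1).filter (fun e' => M.Coplanar e e' ∧ e' ≠ e) with hS
  let η : E d → ℝ := fun y => ∏ e' ∈ S, Metric.infDist y e'.1
  have hη : Continuous η := continuous_finsetProd _ fun e' _ => Metric.continuous_infDist_pt _
  have h1 := sum_integral_eq_zero_of_poly M (M.facesOf T.1)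
    (fun e' x => (w e').1 x * c e' * peval (offPlanePoly M T e) x ^ 2)
    (fun e' => ((continuous_of_mem_polyOn _).mul continuous_const).mul
      ((continuous_peval_coe _ _).pow 2)) h (ψ := fun y => peval P y * η y)
    ((continuous_peval P).mul hη)
  rw [Finset.sum_eq_single_of_mem e he] at h1
  · have h2 : ∫ x : e.1, peval P x ^ 2 * peval (offPlanePoly M T e) x ^ 2 * η x ∂(surfOn e.1)
        = 0 := by
      rw [← mul_eq_zero_iff_left hc, ← h1, ← integral_const_mul]
      refine integral_congr_ae (.of_forall fun x => ?_)
      simp only [hPx]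
      ring
    have h3 := eq_zero_of_integral_eq_zero
      ((((continuous_peval_coe P e.1).pow 2).mul ((continuous_peval_coe _ e.1).pow 2)).mul
        (hη.comp continuous_subtype_val)) (fun x => mul_nonneg
          (mul_nonneg (sq_nonneg _) (sq_nonneg _))
          (Finset.prod_nonneg fun _ _ => Metric.infDist_nonneg)) h2
    have h4 := M.peval_eq_zero_of_mul_prod e _ P (fun e' he' => (Finset.mem_filter.1 he').2)
      (fun x hx => by
        have h5 := congrFun h3 ⟨x, intrinsicInterior_subset hx⟩
        have h6 : η x ≠ 0 := Finset.prod_ne_zero_iff.2 fun e' he' => by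
          obtain ⟨-, hco, hne⟩ := Finset.mem_filter.1 he'
          exact (((M.face_isCompact e').isClosed.notMem_iff_infDist_pos
            ((M.face_nonempty e').mono intrinsicInterior_subset)).1 (hco.notMem hne.symm hx)).ne'
        have h7 := (mul_eq_zero.1 h5).resolve_right h6
        rw [← mul_pow] at h7
        exact pow_eq_zero_iff two_ne_zero |>.1 h7)
    ext x
    rw [hPx, h4 x x.2]
    rfl
  · intro e' he' hne
    refine integral_eq_zero_of_ae (.of_forall fun x => ?_)
    by_cases hco : M.Coplanar e e'
    · have : η x = 0 := Finset.prod_eq_zero (Finset.mem_filter.2 ⟨he', hco, hne⟩)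
        (Metric.infDist_zero_of_mem x.2)
      simp [this]
    · simp [peval_offPlanePoly_eq_zero he' hco x.2]

theorem inner_outNormal_ne_zero (T : Set (E d)) (e : M.faces) :
    inner ℝ (M.normal e.1) (M.outNormal T e.1) ≠ 0 := by
  have h : inner ℝ (M.normal e.1) (M.normal e.1) = (1 : ℝ) := by
    rw [real_inner_self_eq_norm_sq, M.normal_unit e.1 e.2, one_pow]
  unfold PolytopalMesh.outNormal
  split_ifs
  · rw [h]
    exact one_ne_zero
  · rw [inner_neg_right, h]
    norm_num

/-- Boundary data on `∂T` that annihilate all polynomials vanish. The values `v_b` are seen by test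
functions that vanish to first order on the face, the normal derivatives `v_n` by the rest. -/
theorem boundary_eq_zero_of_weakRhs {v : Vh M k} (h0 : v.1 = 0) (T : M.elems)
    (h : ∀ φ, weakRhs M v T φ = 0) (e : M.faces) (he : e ∈ M.facesOf T.1) :
    v.2.1 e = 0 ∧ v.2.2 e = 0 := by
  have hb : ∀ e ∈ M.facesOf T.1, v.2.1 e = 0 := by
    intro e he
    refine face_component_eq_zero he v.2.1
      (fun e' => inner ℝ (M.normal e.1) (M.outNormal T.1 e'.1)) (inner_outNormal_ne_zero T.1 e)
      fun ψ => ?_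
    have h1 := h (offPlanePoly M T e ^ 2 * (ψ * M.facePoly e))
    -- on every face of `T` one of the two factors vanishes
    have h2 : ∀ e' ∈ M.facesOf T.1, ∀ x ∈ e'.1,
        peval (offPlanePoly M T e) x * peval (M.facePoly e) x = 0 := by
      intro e' he' x hx
      by_cases hco : M.Coplanar e e'
      · rw [hco.symm x hx, mul_zero]
      · rw [peval_offPlanePoly_eq_zero he' hco hx, zero_mul]
    have h3 : ∀ e' ∈ M.facesOf T.1,
        ∫ x, (v.2.2 e').1 x * inner ℝ (M.normal e'.1) (M.outNormal T.1 e'.1) *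
          peval (offPlanePoly M T e ^ 2 * (ψ * M.facePoly e)) x ∂(surfOn e'.1) = 0 := by
      intro e' he'
      refine integral_eq_zero_of_ae (.of_forall fun x => ?_)
      have := h2 e' he' x x.2
      simp only [pow_two, peval_mul, Pi.zero_apply]
      linear_combination ((v.2.2 e').1 x * inner ℝ (M.normal e'.1) (M.outNormal T.1 e'.1) *
        peval (offPlanePoly M T e) x * peval ψ x) * this
    have h4 : ∀ e' ∈ M.facesOf T.1, ∫ x, (v.2.1 e').1 x *
          pnormal (offPlanePoly M T e ^ 2 * (ψ * M.facePoly e)) (M.outNormal T.1 e'.1) x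
            ∂(surfOn e'.1) =
        ∫ x, (v.2.1 e').1 x * inner ℝ (M.normal e.1) (M.outNormal T.1 e'.1) *
          peval (offPlanePoly M T e) x ^ 2 * peval ψ x ∂(surfOn e'.1) := by
      intro e' he'
      refine integral_congr_ae (.of_forall fun x => ?_)
      have := h2 e' he' x x.2
      simp only [pow_two, pnormal_mul, peval_mul, M.pnormal_facePoly]
      linear_combination ((v.2.1 e').1 x *
        (2 * pnormal (offPlanePoly M T e) (M.outNormal T.1 e'.1) x * peval ψ x +
          peval (offPlanePoly M T e) x * pnormal ψ (M.outNormal T.1 e'.1) x)) * this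
    rw [weakRhs, Finset.sum_eq_zero h3, Finset.sum_congr rfl h4] at h1
    simpa [h0] using h1
  refine ⟨hb e he, face_component_eq_zero he v.2.2
    (fun e' => inner ℝ (M.normal e'.1) (M.outNormal T.1 e'.1)) (inner_outNormal_ne_zero T.1 e)
    fun ψ => ?_⟩
  have h1 := h (offPlanePoly M T e ^ 2 * ψ)
  have h2 : ∀ e' ∈ M.facesOf T.1, ∫ x, (v.2.1 e').1 x *
      pnormal (offPlanePoly M T e ^ 2 * ψ) (M.outNormal T.1 e'.1) x ∂(surfOn e'.1) = 0 := by
    intro e' he'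
    simp [hb e' he']
  rw [weakRhs, Finset.sum_eq_zero h2] at h1
  simpa [h0, pow_two, peval_mul, mul_assoc] using h1

instance (m : ℕ) (D : Set (E d)) : Module.Finite ℝ (polyOn m D) := by
  unfold polyOn
  infer_instance

/-- The weak functions without interior component whose weak Laplacian of degree `j` vanishes. -/
def weakKernel (M : PolytopalMesh d Ω) (k j : ℕ) : Submodule ℝ (Vh M k) where
  carrier := {v | v.1 = 0 ∧ ∀ T, ∀ φ ∈ MvPolynomial.restrictTotalDegree (Fin d) ℝ j,
    weakRhs M v T φ = 0}
  add_mem' := by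
    rintro v w ⟨hv, hv'⟩ ⟨hw, hw'⟩
    exact ⟨by simp [hv, hw], fun T φ hφ => by
      rw [weakRhs_add_left, hv' T φ hφ, hw' T φ hφ, add_zero]⟩
  zero_mem' := ⟨rfl, fun T φ _ => by
    simpa using weakRhs_smul_left (0 : ℝ) (0 : Vh M k) T φ⟩
  smul_mem' := by
    rintro r v ⟨hv, hv'⟩
    exact ⟨by simp [hv], fun T φ hφ => by rw [weakRhs_smul_left, hv' T φ hφ, mul_zero]⟩

/-- For large `j` the weak Laplacian is injective on the weak functions without interior
component: the kernels decrease with `j` in a finite-dimensional space, so they become constant,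
and their intersection is trivial. -/
theorem exists_degree_unisolvent (M : PolytopalMesh d Ω) (k : ℕ) :
    ∃ j₀ : ℕ, ∀ j ≥ j₀, ∀ v : Vh M k, v.1 = 0 → aw M j v v = 0 → v = 0 := by
  have hanti : Antitone (weakKernel M k) := fun i j hij v hv =>
    ⟨hv.1, fun T φ hφ => hv.2 T φ (by
      rw [MvPolynomial.mem_restrictTotalDegree] at hφ ⊢
      exact hφ.trans hij)⟩
  obtain ⟨j₀, hj₀⟩ := IsArtinian.monotone_stabilizes
    (⟨fun j => OrderDual.toDual (weakKernel M k j), fun i j hij => hanti hij⟩ :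
      ℕ →o (Submodule ℝ (Vh M k))ᵒᵈ)
  refine ⟨j₀, fun j hj v h0 hv => ?_⟩
  have hvj : v ∈ weakKernel M k j := ⟨h0, fun T φ hφ =>
    weakRhs_eq_zero_of_weakLaplacian_eq_zero (weakLaplacian_eq_zero_of_aw_self hv T) hφ⟩
  have hall : ∀ T φ, weakRhs M v T φ = 0 := by
    intro T φ
    have hmem : v ∈ weakKernel M k (max j₀ φ.totalDegree) := by
      have h1 : weakKernel M k j₀ = weakKernel M k (max j₀ φ.totalDegree) :=
        hj₀ _ (le_max_left _ _)
      exact h1 ▸ hanti hj hvj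
    exact hmem.2 T φ ((MvPolynomial.mem_restrictTotalDegree _ _ _).2 (le_max_right _ _))
  have hface : ∀ e : M.faces, v.2.1 e = 0 ∧ v.2.2 e = 0 := by
    intro e
    obtain ⟨T, hT, heT⟩ := M.face_incident e.1 e.2
    exact boundary_eq_zero_of_weakRhs h0 ⟨T, hT⟩ (hall _) e (by
      simpa [PolytopalMesh.facesOf] using heT)
  exact Prod.ext h0 (Prod.ext (funext fun e => (hface e).1) (funext fun e => (hface e).2))

/-! ### Functions in `H¹(0, t̄; V)` -/

section H1
variable {V W : Type*} [AddCommGroup V] [Module ℝ V] [AddCommGroup W] [Module ℝ W]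
  {tbar : ℝ} {w w' : ℝ → V}

theorem IsH1.comp (h : IsH1 tbar w w') (A : V →ₗ[ℝ] W) :
    IsH1 tbar (fun t => A (w t)) (fun t => A (w' t)) := fun l => h (l.comp A)

theorem IsH1.add_const (h : IsH1 tbar w w') (c : V) : IsH1 tbar (fun t => w t + c) w' := by
  intro l
  refine ⟨(h l).1, fun t ht => ?_⟩
  simp only [map_add]
  rw [(h l).2 t ht]
  ring

theorem IsH1.integrable (h : IsH1 tbar w w') (l : Module.Dual ℝ V) :
    IntegrableOn (fun t => l (w' t)) (Ioc 0 tbar) :=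
  (h l).1.integrable one_le_two

theorem IsH1.sub {u u' : ℝ → V} (h : IsH1 tbar w w') (hu : IsH1 tbar u u') :
    IsH1 tbar (fun t => w t - u t) (fun t => w' t - u' t) := by
  intro l
  simp only [map_sub]
  refine ⟨(h l).1.sub (hu l).1, fun t ht => ?_⟩
  have hi : ∀ {v v' : ℝ → V}, IsH1 tbar v v' →
      IntervalIntegrable (fun t => l (v' t)) volume 0 t := fun hv =>
    (intervalIntegrable_iff_integrableOn_Ioc_of_le ht.1).2
      ((hv.integrable l).mono_set (Ioc_subset_Ioc_right ht.2))
  rw [intervalIntegral.integral_sub (hi h) (hi hu), (h l).2 t ht, (hu l).2 t ht]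
  ring

theorem IsH1.continuousOn (h : IsH1 tbar w w') (l : Module.Dual ℝ V) :
    ContinuousOn (fun t => l (w t)) (Icc 0 tbar) := by
  rcases le_or_gt 0 tbar with h0 | h0
  · have hc : ContinuousOn (fun t => l (w 0) + ∫ s in (0 : ℝ)..t, l (w' s)) (Icc 0 tbar) := by
      refine continuousOn_const.add ?_
      rw [← uIcc_of_le h0]
      refine intervalIntegral.continuousOn_primitive_interval ?_
      rw [uIcc_of_le h0, integrableOn_Icc_iff_integrableOn_Ioc]
      exact h.integrable l
    exact hc.congr fun t ht => (h l).2 t ht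
  · simp [Icc_eq_empty h0.not_ge]

theorem IsH1.eq_zero_of_ae (h : IsH1 tbar w w') (h0 : 0 < tbar) (l : Module.Dual ℝ V)
    (hl : ∀ᵐ t ∂(volume.restrict (Ioc 0 tbar)), l (w t) = 0) : ∀ t ∈ Icc 0 tbar, l (w t) = 0 := by
  rw [Measure.restrict_congr_set Ioc_ae_eq_Icc] at hl
  exact Measure.eqOn_Icc_of_ae_eq volume h0.ne (g := fun _ => 0) hl (h.continuousOn l)
    continuousOn_const

end H1

/-! ### Linear systems of ordinary differential equations with square integrable data -/

section ODE
variable {ι : Type*} [Fintype ι] {tbar : ℝ}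

/-- The system `b' = A b + g` has a solution in `H¹` with any initial value: with a primitive `G`
of `g`, the difference `b - G` solves a system with the continuous right-hand side `A G`, which
variation of constants solves. -/
theorem exists_isH1_linear (A : (ι → ℝ) →ₗ[ℝ] (ι → ℝ)) {g : ℝ → ι → ℝ}
    (hg : ∀ i, MemLp (fun t => g t i) 2 (volume.restrict (Ioc 0 tbar))) (b₀ : ι → ℝ) :
    ∃ b b' : ℝ → ι → ℝ, IsH1 tbar b b' ∧ b 0 = b₀ ∧ ∀ t, b' t = A (b t) + g t := by
  let L : (ι → ℝ) →L[ℝ] (ι → ℝ) := LinearMap.toContinuousLinearMap A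
  have hgL : MemLp g 2 (volume.restrict (Ioc 0 tbar)) := memLp_pi_iff.2 hg
  let g₁ : ℝ → ι → ℝ := (Ioc 0 tbar).indicator g
  have hg₁ : Integrable g₁ :=
    (integrable_indicator_iff measurableSet_Ioc).2 (hgL.integrable one_le_two)
  let G : ℝ → ι → ℝ := fun t => ∫ s in (0 : ℝ)..t, g₁ s
  have hG : Continuous G := intervalIntegral.continuous_primitive
    (fun _ _ => hg₁.intervalIntegrable) 0
  let X : ℝ → (ι → ℝ) →L[ℝ] (ι → ℝ) := fun t => NormedSpace.exp (t • L)
  have hX : ∀ t, HasDerivAt X (L * X t) t := fun t => hasDerivAt_exp_smul_const' L t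
  have hXc : Continuous X := continuous_iff_continuousAt.2 fun t => (hX t).continuousAt
  have hXX : ∀ t, X t * X (-t) = 1 := by
    intro t
    have hcomm : Commute (t • L) ((-t) • L) := (Commute.refl L).smul_left _ |>.smul_right _
    let _ : NormedAlgebra ℚ ((ι → ℝ) →L[ℝ] (ι → ℝ)) := NormedAlgebra.restrictScalars ℚ ℝ _
    have := NormedSpace.exp_add_of_commute hcomm
    simp only [X]
    rw [← this, ← add_smul, add_neg_cancel, zero_smul, NormedSpace.exp_zero]
  have hint : Continuous fun s => X (-s) (L (G s)) :=
    (hXc.comp continuous_neg).clm_apply (L.continuous.comp hG)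
  let c : ℝ → ι → ℝ := fun t => X t (b₀ + ∫ s in (0 : ℝ)..t, X (-s) (L (G s)))
  have hc : ∀ t, HasDerivAt c (L (c t + G t)) t := by
    intro t
    have h1 : HasDerivAt (fun t => b₀ + ∫ s in (0 : ℝ)..t, X (-s) (L (G s))) (X (-t) (L (G t))) t :=
      (hint.integral_hasStrictDerivAt 0 t).hasDerivAt.const_add b₀
    have h2 := (hX t).clm_apply h1
    refine h2.congr_deriv ?_
    have h3 : X t (X (-t) (L (G t))) = L (G t) := by
      rw [← mul_apply_eq_comp, hXX]
      rfl
    rw [h3]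
    exact (map_add L (c t) (G t)).symm
  have hcc : Continuous c := continuous_iff_continuousAt.2 fun t => (hc t).continuousAt
  have hbc : Continuous fun t => L (c t + G t) := L.continuous.comp (hcc.add hG)
  refine ⟨fun t => c t + G t, fun t => L (c t + G t) + g t, ?_, ?_, fun t => rfl⟩
  · intro l
    let l' : (ι → ℝ) →L[ℝ] ℝ := LinearMap.toContinuousLinearMap l
    have hsq : MemLp (fun t => L (c t + G t) + g t) 2 (volume.restrict (Ioc 0 tbar)) := by
      refine MemLp.add ?_ hgL
      obtain ⟨B, hB⟩ := isCompact_Icc.exists_bound_of_continuousOn (s := Icc 0 tbar)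
        hbc.continuousOn
      refine MemLp.of_bound hbc.aestronglyMeasurable B ?_
      filter_upwards [ae_restrict_mem measurableSet_Ioc] with t ht
      exact hB t (Ioc_subset_Icc_self ht)
    refine ⟨l'.comp_memLp' hsq, fun t ht => ?_⟩
    have hgi : IntervalIntegrable g volume 0 t :=
      (intervalIntegrable_iff_integrableOn_Ioc_of_le ht.1).2
        ((show IntegrableOn g (Ioc 0 tbar) volume from hgL.integrable one_le_two).mono_set
          (Ioc_subset_Ioc_right ht.2))
    have hGt : G t = ∫ s in (0 : ℝ)..t, g s := by
      refine intervalIntegral.integral_congr_ae (.of_forall fun s hs => ?_)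
      rw [uIoc_of_le ht.1] at hs
      exact indicator_of_mem (Ioc_subset_Ioc_right ht.2 hs) g
    have h1 : ∫ s in (0 : ℝ)..t, (L (c s + G s) + g s) = (c t - c 0) + G t := by
      rw [intervalIntegral.integral_add (hbc.intervalIntegrable _ _) hgi, hGt,
        intervalIntegral.integral_eq_sub_of_hasDerivAt (fun s _ => hc s)
          (hbc.intervalIntegrable _ _)]
    have h2 : ∫ s in (0 : ℝ)..t, l (L (c s + G s) + g s) = l (c t - c 0 + G t) := by
      rw [← h1]
      exact l'.intervalIntegral_comp_comm ((hbc.intervalIntegrable _ _).add hgi)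
    have hG0 : G 0 = 0 := intervalIntegral.integral_same
    change l (c t + G t) = l (c 0 + G 0) + _
    rw [h2, ← map_add, hG0]
    congr 1
    abel
  · simp [c, G, X, NormedSpace.exp_zero]

/-- A solution in `H¹` of `b' = A b` with `b(0) = 0` vanishes. -/
theorem eq_zero_of_isH1_linear (A : (ι → ℝ) →ₗ[ℝ] (ι → ℝ)) {b b' : ℝ → ι → ℝ}
    (hb : IsH1 tbar b b') (hb0 : b 0 = 0)
    (h : ∀ᵐ t ∂(volume.restrict (Ioc 0 tbar)), b' t = A (b t)) :
    ∀ t ∈ Icc 0 tbar, b t = 0 := by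
  intro t ht
  have h0 : 0 ≤ tbar := ht.1.trans ht.2
  let L : (ι → ℝ) →L[ℝ] (ι → ℝ) := LinearMap.toContinuousLinearMap A
  have hbc : ContinuousOn b (Icc 0 tbar) :=
    continuousOn_pi.2 fun i => hb.continuousOn (LinearMap.proj i)
  -- a continuous extension, so that the integral is differentiable at the end points too
  let c : ℝ → ι → ℝ := IccExtend h0 ((Icc 0 tbar).domRestrict b)
  have hc : Continuous c := (continuousOn_iff_continuous_domRestrict.1 hbc).Icc_extend'
  have hcb : ∀ s ∈ Icc 0 tbar, c s = b s := fun s hs => IccExtend_of_mem h0 _ hs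
  have hLc : Continuous fun s => L (c s) := L.continuous.comp hc
  let y : ℝ → ι → ℝ := fun t => ∫ s in (0 : ℝ)..t, L (c s)
  have hy : ∀ s, HasDerivAt y (L (c s)) s := fun s => (hLc.integral_hasStrictDerivAt 0 s).hasDerivAt
  have hyb : ∀ s ∈ Icc 0 tbar, y s = b s := by
    intro s hs
    ext i
    have h1 := (hb (LinearMap.proj i)).2 s hs
    simp only [LinearMap.proj_apply, hb0, Pi.zero_apply, zero_add] at h1
    rw [h1]
    have h2 := (ContinuousLinearMap.proj (R := ℝ) (φ := fun _ : ι => ℝ) i)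
      |>.intervalIntegral_comp_comm
      (hLc.intervalIntegrable (μ := volume) 0 s)
    refine h2.symm.trans (intervalIntegral.integral_congr_ae ?_)
    rw [ae_restrict_iff' measurableSet_Ioc] at h
    filter_upwards [h] with r hr hrs
    rw [uIoc_of_le hs.1] at hrs
    have hr' := Ioc_subset_Ioc_right hs.2 hrs
    rw [hr hr', ← hcb r (Ioc_subset_Icc_self hr')]
    rfl
  rw [← hyb t ht]
  refine eq_zero_of_abs_deriv_le_mul_abs_self_of_eq_zero_right (f' := fun s => L (c s)) (K := ‖L‖)
    (fun s _ => (hy s).continuousAt.continuousWithinAt) (fun s _ => (hy s).hasDerivWithinAt)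
    intervalIntegral.integral_same (fun s hs => ?_) t ht
  have hs' := Ico_subset_Icc_self hs
  rw [hyb s hs', ← hcb s hs']
  exact L.le_opNorm _

end ODE

/-! ### The load functional -/

theorem sq_integral_le {α : Type*} [MeasurableSpace α] {μ : Measure α} [IsFiniteMeasure μ]
    {h : α → ℝ} (hh : Integrable h μ) (hh2 : Integrable (fun x => h x ^ 2) μ) :
    (∫ x, h x ∂μ) ^ 2 ≤ μ.real univ * ∫ x, h x ^ 2 ∂μ := by
  set m := μ.real univ with hm
  set c := ∫ x, h x ∂μ with hc
  have hm0 : 0 ≤ m := measureReal_nonneg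
  have h1 : ∫ x, (m * h x - c) ^ 2 ∂μ = m * (m * ∫ x, h x ^ 2 ∂μ - c ^ 2) := by
    have h2 : ∀ x, (m * h x - c) ^ 2 = m ^ 2 * h x ^ 2 - 2 * m * c * h x + c ^ 2 := fun x => by ring
    simp only [h2]
    rw [integral_add (f := fun x => m ^ 2 * h x ^ 2 - 2 * m * c * h x)
        ((hh2.const_mul _).sub (hh.const_mul _)) (integrable_const _),
      integral_sub (hh2.const_mul _) (hh.const_mul _), integral_const_mul, integral_const_mul,
      integral_const, smul_eq_mul, ← hm, ← hc]
    ring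
  have h3 : 0 ≤ m * (m * ∫ x, h x ^ 2 ∂μ - c ^ 2) := h1 ▸ integral_nonneg fun x => sq_nonneg _
  rcases hm0.eq_or_lt with h0 | h0
  · have : μ = 0 := by
      rw [← Measure.measure_univ_eq_zero]
      exact (measureReal_eq_zero_iff).1 h0.symm
    simp [hc, this]
  · linarith [nonneg_of_mul_nonneg_right h3 h0]

variable {tbar : ℝ} {f : ℝ → E d → ℝ}

theorem IsSource.memLp_mul_peval (hf : IsSource Ω tbar f) (T : M.elems)
    (P : MvPolynomial (Fin d) ℝ) : MemLp (fun z : ℝ × E d => f z.1 z.2 * peval P z.2) 2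
      ((volume.restrict (Ioc 0 tbar)).prod (volume.restrict T.1)) := by
  have h1 := hf.mono_measure (Measure.prod_mono le_rfl (M.restrict_elem_le T))
  obtain ⟨C, hC⟩ := (M.elem_isCompact T).exists_bound_of_continuousOn
    (continuous_peval P).continuousOn
  refine MemLp.of_le_mul (c := C) h1 (h1.aestronglyMeasurable.mul
    ((continuous_peval P).comp continuous_snd).aestronglyMeasurable) ?_
  have h2 : ∀ᵐ x ∂((volume : Measure (E d)).restrict T.1), ‖peval P x‖ ≤ C := by
    filter_upwards [ae_restrict_mem (M.elem_isCompact T).measurableSet] with x hx using hC x hx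
  filter_upwards [Measure.quasiMeasurePreserving_snd.ae h2] with z hz
  rw [norm_mul, mul_comm]
  gcongr

theorem integral_volOn (T : M.elems) (g : E d → ℝ) :
    ∫ x, g x ∂(volOn T.1) = ∫ x in T.1, g x :=
  integral_subtype_comap (M.elem_isCompact T).measurableSet g

theorem finite_restrict_elem (T : M.elems) :
    IsFiniteMeasure ((volume : Measure (E d)).restrict T.1) :=
  ⟨by simpa using (M.elem_isCompact T).measure_lt_top⟩

theorem memLp_load (hf : IsSource Ω tbar f) (v : ∀ T : M.elems, polyOn k T.1) :
    MemLp (fun t => load M (f t) v) 2 (volume.restrict (Ioc 0 tbar)) := by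
  refine memLp_finsetSum _ fun T _ => ?_
  obtain ⟨P, -, hP⟩ := (v T).2
  have := finite_restrict_elem T
  have h1 := hf.memLp_mul_peval T P
  have h2 : ∀ t, ∫ x, f t x * (v T).1 x ∂(volOn T.1) = ∫ x in T.1, f t x * peval P x := by
    intro t
    rw [← integral_volOn, ← hP]
    rfl
  simp only [h2]
  have hm : AEStronglyMeasurable (fun t => ∫ x in T.1, f t x * peval P x)
      (volume.restrict (Ioc 0 tbar)) := h1.aestronglyMeasurable.integral_prod_right'
  rw [memLp_two_iff_integrable_sq hm]
  have h3 := (memLp_two_iff_integrable_sq h1.aestronglyMeasurable).1 h1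
  refine (h3.integral_prod_left.const_mul
    (((volume : Measure (E d)).restrict T.1).real univ)).mono' (hm.pow 2) ?_
  filter_upwards [(h1.integrable one_le_two).prod_right_ae, h3.prod_right_ae] with t ht ht'
  rw [Real.norm_of_nonneg (sq_nonneg _)]
  exact sq_integral_le ht ht'

theorem ae_integrable_source (M : PolytopalMesh d Ω) (hf : IsSource Ω tbar f) :
    ∀ᵐ t ∂(volume.restrict (Ioc 0 tbar)), ∀ T : M.elems,
      Integrable (fun x : T.1 => f t x) (volOn T.1) := by
  rw [ae_all_iff]
  intro T
  have := finite_restrict_elem T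
  have h1 := hf.mono_measure (Measure.prod_mono le_rfl (M.restrict_elem_le T))
  filter_upwards [(h1.integrable one_le_two).prod_right_ae] with t ht
  rw [← map_comap_subtype_coe (M.elem_isCompact T).measurableSet] at ht
  exact (MeasurableEmbedding.subtype_coe (M.elem_isCompact T).measurableSet).integrable_map_iff.1 ht

/-- For an integrable `g`, the functional `load M g` is linear; in general it need not be, because
of the value `0` of integrals of functions that are not integrable. -/
theorem exists_load_linear (k : ℕ) {g : E d → ℝ}
    (hg : ∀ T : M.elems, Integrable (fun x : T.1 => g x) (volOn T.1)) :
    ∃ l : Module.Dual ℝ (∀ T : M.elems, polyOn k T.1), ∀ v, l v = load M g v := by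
  have hi : ∀ (v : ∀ T : M.elems, polyOn k T.1) (T : M.elems),
      Integrable (fun x : T.1 => g x * (v T).1 x) (volOn T.1) := by
    intro v T
    obtain ⟨C, hC⟩ := isCompact_univ.exists_bound_of_continuousOn
      (continuous_of_mem_polyOn (v T)).continuousOn
    exact (hg T).mul_bdd (c := C) (continuous_of_mem_polyOn (v T)).aestronglyMeasurable
      (.of_forall fun x => hC x (mem_univ x))
  refine ⟨{ toFun := load M g, map_add' := fun u v => ?_, map_smul' := fun r v => ?_ },
    fun v => rfl⟩
  · simp only [load, Pi.add_apply, Submodule.coe_add, mul_add, ← Finset.sum_add_distrib]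
    exact Finset.sum_congr rfl fun T _ => integral_add (hi u T) (hi v T)
  · simp only [load, Pi.smul_apply, Submodule.coe_smul, smul_eq_mul, integral_mul_smul,
      Finset.mul_sum, RingHom.id_apply]

/-! ### The projection `Q_h` has vanishing boundary components -/

theorem l2proj_eq_zero {m : ℕ} {D : Set (E d)} [CompactSpace D] {μ : Measure D}
    [IsFiniteMeasure μ] [μ.IsOpenPosMeasure] {g : D → ℝ} (hg : g =ᵐ[μ] 0) :
    l2proj μ (polyOn m D) g = 0 := by
  unfold l2proj
  split_ifs with h
  · have h1 := h.choose_spec h.choose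
    have h2 : ∫ x, g x * h.choose.1 x ∂μ = 0 := by
      refine integral_eq_zero_of_ae ?_
      filter_upwards [hg] with x hx
      simp [hx]
    exact Subtype.ext (eq_zero_of_integral_mul_self (continuous_of_mem_polyOn _) (h1.trans h2))
  · rfl

/-- This covers the default value `0` of `trace` as well. -/
theorem trace_ae_eq_zero {e : Set (E d)} {B : (E d → ℝ) → E d → ℝ} {ψ : E d → ℝ}
    (hψ : MemH20 Ω ψ) (hB : ∀ φ, IsTest Ω φ → ∀ x ∈ e, B φ x = 0) :
    trace Ω e B ψ =ᵐ[surfOn e] 0 := by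
  unfold trace
  split_ifs with h
  · obtain ⟨hg, hlim⟩ := h.choose_spec
    set g := h.choose
    obtain ⟨φ, hφ⟩ := hψ.2
    have h1 : ∀ n, ∫ x : e, (B (φ n) x - g x) ^ 2 ∂(surfOn e) = ∫ x, g x ^ 2 ∂(surfOn e) :=
      fun n => integral_congr_ae (.of_forall fun x => by simp [hB _ (hφ.1 n) x x.2])
    have h2 := hlim φ hφ
    simp only [h1] at h2
    have h3 := tendsto_nhds_unique tendsto_const_nhds h2
    rw [integral_eq_zero_iff_of_nonneg (fun x => sq_nonneg _)
      ((memLp_two_iff_integrable_sq hg.aestronglyMeasurable).1 hg)] at h3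
    filter_upwards [h3] with x hx
    exact pow_eq_zero_iff two_ne_zero |>.1 hx
  · rfl

theorem Qh_mem (M : PolytopalMesh d Ω) (hΩ : IsOpen Ω) (k : ℕ) {ψ : E d → ℝ}
    (hψ : MemH20 Ω ψ) : Qh M k ψ ∈ Vh0 M k := by
  have hout : ∀ e : M.faces, e.1 ⊆ frontier Ω → ∀ φ, IsTest Ω φ → ∀ x ∈ e.1, x ∉ tsupport φ :=
    fun e he φ hφ x hx hx' => (hΩ.frontier_eq ▸ he hx).2 (hφ.2.2 hx')
  refine ⟨Submodule.mem_top, fun e he => l2proj_eq_zero (trace_ae_eq_zero hψ fun φ hφ x hx => ?_),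
    fun e he => l2proj_eq_zero (trace_ae_eq_zero hψ fun φ hφ x hx => ?_)⟩
  · exact image_eq_zero_of_notMem_tsupport (hout e he φ hφ x hx)
  · rw [image_eq_zero_of_notMem_tsupport fun h => hout e he φ hφ x hx (tsupport_fderiv_subset ℝ h)]
    rfl

-- needed for the additive group structures on the nested subspaces of dependent products
set_option maxSynthPendingDepth 3

/-! ### The splitting of `V_h^0` into interior and boundary components -/

variable (M) (k)

/-- The space of the interior components `v_0`. -/
abbrev IntSpace : Type := ∀ T : M.elems, polyOn k T.1

/-- The space of the boundary components `(v_b, v_n)` of elements of `V_h^0`. -/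
abbrev BdrySpace : Type := faceSpace M k × faceSpace M (k - 1)

/-- `v_0 ↦ (v_0, 0, 0)`. -/
def incInt : IntSpace k M →ₗ[ℝ] Vh0 M k :=
  (LinearMap.inl ℝ (IntSpace k M) _).codRestrict (Vh0 M k)
    fun _ => ⟨Submodule.mem_top, Submodule.zero_mem _⟩

/-- `(v_b, v_n) ↦ (0, v_b, v_n)`. -/
def incBdry : BdrySpace k M →ₗ[ℝ] Vh0 M k :=
  ((LinearMap.inr ℝ (IntSpace k M) _).comp
    ((faceSpace M k).subtype.prodMap (faceSpace M (k - 1)).subtype)).codRestrict (Vh0 M k)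
    fun β => ⟨Submodule.mem_top, β.1.2, β.2.2⟩

/-- The interior component of an element of `V_h^0`. -/
def intPart : Vh0 M k →ₗ[ℝ] IntSpace k M := (LinearMap.fst ℝ _ _).comp (Vh0 M k).subtype

/-- The boundary components of an element of `V_h^0`. -/
def bdryPart : Vh0 M k →ₗ[ℝ] BdrySpace k M :=
  (((LinearMap.fst ℝ _ _).comp ((LinearMap.snd ℝ _ _).comp (Vh0 M k).subtype)).codRestrict
    (faceSpace M k) fun v => v.2.2.1).prod
  (((LinearMap.snd ℝ _ _).comp ((LinearMap.snd ℝ _ _).comp (Vh0 M k).subtype)).codRestrict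
    (faceSpace M (k - 1)) fun v => v.2.2.2)

variable {M k}

@[simp] theorem intPart_apply (v : Vh0 M k) : intPart k M v = v.1.1 := rfl

theorem incInt_add_incBdry (v : Vh0 M k) :
    incInt k M (intPart k M v) + incBdry k M (bdryPart k M v) = v :=
  Subtype.ext (Prod.ext (add_zero _) (Prod.ext (zero_add _) (zero_add _)))


variable (M k) in
/-- `(Δ_w u, Δ_w v)` on `V_h^0`. -/
def awForm0 (j : ℕ) : LinearMap.BilinForm ℝ (Vh0 M k) :=
  (awForm k M j).compl₁₂ (Vh0 M k).subtype (Vh0 M k).subtype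

@[simp] theorem awForm0_apply (j : ℕ) (u v : Vh0 M k) : awForm0 k M j u v = aw M j u.1 v.1 := rfl

/-! ### Elimination of the boundary components -/

/-- Solvability of a symmetric linear system whose right-hand side annihilates the kernel. -/
theorem mem_range_bilinForm_of_annihilates {B : Type*} [AddCommGroup B] [Module ℝ B]
    [FiniteDimensional ℝ B] (F : LinearMap.BilinForm ℝ B) (hF : ∀ x y, F x y = F y x)
    (ξ : Module.Dual ℝ B) (hξ : ∀ x, F x = 0 → ξ x = 0) : ∃ x, F x = ξ := by
  have h1 : ξ ∈ LinearMap.range (LinearMap.dualMap F) := by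
    rw [LinearMap.range_dualMap_eq_dualAnnihilator_ker, Submodule.mem_dualAnnihilator]
    exact fun x hx => hξ x hx
  obtain ⟨Θ, rfl⟩ := h1
  obtain ⟨x, rfl⟩ := (Module.evalEquiv ℝ B).surjective Θ
  exact ⟨x, LinearMap.ext fun y => hF x y⟩

/-- For every `j` the boundary components can be chosen as a linear function of the interior
component in such a way that the equations with `v_0 = 0` hold. The system for them may be singular,
but it is symmetric, and the weak functions in its kernel have zero energy, so that its right-hand
side annihilates the kernel. -/
theorem exists_boundary_lift (M : PolytopalMesh d Ω) (k j : ℕ) :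
    ∃ S : IntSpace k M →ₗ[ℝ] BdrySpace k M, ∀ x β,
      awForm0 k M j (incInt k M x + incBdry k M (S x)) (incBdry k M β) = 0 := by
  let F : BdrySpace k M →ₗ[ℝ] Module.Dual ℝ (BdrySpace k M) :=
    (awForm0 k M j).compl₁₂ (incBdry k M) (incBdry k M)
  let G : IntSpace k M →ₗ[ℝ] Module.Dual ℝ (BdrySpace k M) :=
    (awForm0 k M j).compl₁₂ (incInt k M) (incBdry k M)
  have hGF : ∀ x, G x ∈ LinearMap.range F := by
    intro x
    refine mem_range_bilinForm_of_annihilates F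
      (fun x y => aw_comm j (incBdry k M x).1 (incBdry k M y).1) _ ?_
    intro β hβ
    have h1 : aw M j (incBdry k M β).1 (incBdry k M β).1 = 0 := LinearMap.congr_fun hβ β
    exact (aw_comm j _ _).trans (aw_eq_zero_of_aw_self h1 _)
  let φ := Module.finBasis ℝ (IntSpace k M)
  choose β hβ using fun i => hGF (φ i)
  have hR : F.comp (φ.constr ℝ β) = G := φ.ext fun i => by simp [hβ]
  refine ⟨-(φ.constr ℝ β), fun x β => ?_⟩
  have h1 := LinearMap.congr_fun hR x
  have h2 := LinearMap.congr_fun h1 β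
  rw [LinearMap.neg_apply, map_neg, map_add, map_neg, LinearMap.add_apply, LinearMap.neg_apply]
  exact add_neg_eq_zero.2 h2.symm

/-! ### Existence of solutions for every degree of the weak Laplacian -/

theorem exists_isH1_linear_of_finite {V : Type*} [AddCommGroup V] [Module ℝ V]
    [FiniteDimensional ℝ V] {tbar : ℝ} (A : V →ₗ[ℝ] V) {g : ℝ → V}
    (hg : ∀ l : Module.Dual ℝ V, MemLp (fun t => l (g t)) 2 (volume.restrict (Ioc 0 tbar)))
    (b₀ : V) : ∃ b b' : ℝ → V, IsH1 tbar b b' ∧ b 0 = b₀ ∧ ∀ t, b' t = A (b t) + g t := by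
  let φ := (Module.finBasis ℝ V).equivFun
  obtain ⟨b, b', hb, hb0, hbt⟩ := exists_isH1_linear (tbar := tbar)
    (φ.toLinearMap ∘ₗ A ∘ₗ φ.symm.toLinearMap) (g := fun t => φ (g t))
    (fun i => hg (LinearMap.proj i ∘ₗ φ.toLinearMap)) (φ b₀)
  refine ⟨_, _, hb.comp φ.symm.toLinearMap, by simp [hb0], fun t => ?_⟩
  simp [hbt]

/-- The mass form is invertible. -/
theorem exists_massSolve (M : PolytopalMesh d Ω) (k : ℕ) :
    ∃ R : Module.Dual ℝ (IntSpace k M) →ₗ[ℝ] IntSpace k M, ∀ l v, ip0 M (R l) v = l v := by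
  let J : IntSpace k M →ₗ[ℝ] Module.Dual ℝ (IntSpace k M) := ipForm k M
  have hJ : Function.Injective J := by
    rw [injective_iff_map_eq_zero]
    exact fun x hx => eq_zero_of_ip0_self (LinearMap.congr_fun hx x)
  let e := LinearEquiv.ofInjectiveOfFinrankEq J hJ Subspace.dual_finrank_eq.symm
  exact ⟨e.symm.toLinearMap, fun l v => LinearMap.congr_fun (e.apply_symm_apply l) v⟩


/-- The load functional in a basis; it is linear for every `t`, and agrees with `load` for almost
every `t`. -/
theorem exists_load_representative (hf : IsSource Ω tbar f) (M : PolytopalMesh d Ω) (k : ℕ) :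
    ∃ F : ℝ → Module.Dual ℝ (IntSpace k M),
      (∀ l : Module.Dual ℝ (Module.Dual ℝ (IntSpace k M)),
        MemLp (fun t => l (F t)) 2 (volume.restrict (Ioc 0 tbar))) ∧
      ∀ᵐ t ∂(volume.restrict (Ioc 0 tbar)), ∀ v, F t v = load M (f t) v := by
  let φ := Module.finBasis ℝ (IntSpace k M)
  refine ⟨fun t => ∑ i, load M (f t) (φ i) • φ.coord i, fun l => ?_, ?_⟩
  · simp only [map_sum, map_smul, smul_eq_mul]
    exact memLp_finsetSum _ fun i _ => (memLp_load hf (φ i)).mul_const _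
  · filter_upwards [ae_integrable_source M hf] with t ht v
    obtain ⟨l, hl⟩ := exists_load_linear k ht
    simp only [← hl]
    rw [φ.sum_dual_apply_smul_coord l]

/-- With the boundary components a linear function of the interior one, up to a constant `c` of
zero energy, the scheme is a linear system of ordinary differential equations. -/
theorem exists_solvesScheme (hf : IsSource Ω tbar f) (j : ℕ)
    {S : IntSpace k M →ₗ[ℝ] BdrySpace k M}
    (hS : ∀ x β, awForm0 k M j (incInt k M x + incBdry k M (S x)) (incBdry k M β) = 0)
    (x₀ : IntSpace k M) {c : Vh0 M k} (hc : ∀ v, awForm0 k M j c v = 0) :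
    ∃ w w' : ℝ → Vh0 M k, SolvesScheme M k j tbar f w w' ∧
      w 0 = incInt k M x₀ + incBdry k M (S x₀) + c := by
  obtain ⟨R, hR⟩ := exists_massSolve M k
  obtain ⟨F, hF, hFl⟩ := exists_load_representative hf M k
  let W : IntSpace k M →ₗ[ℝ] Vh0 M k := incInt k M + incBdry k M ∘ₗ S
  let K : IntSpace k M →ₗ[ℝ] Module.Dual ℝ (IntSpace k M) :=
    (awForm0 k M j).compl₁₂ W (incInt k M)
  obtain ⟨b, b', hb, hb0, hbt⟩ := exists_isH1_linear_of_finite (tbar := tbar) (-(R ∘ₗ K))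
    (g := fun t => R (F t)) (fun l => hF (l ∘ₗ R)) x₀
  refine ⟨_, _, ⟨(hb.comp W).add_const c, ?_⟩, by rw [hb0]; rfl⟩
  filter_upwards [hFl] with t ht v
  have h1 : (W (b' t)).1.1 = b' t := add_zero _
  have h2 : awForm0 k M j (W (b t) + c) v = K (b t) v.1.1 := by
    rw [map_add, LinearMap.add_apply, hc, add_zero]
    nth_rw 1 [← incInt_add_incBdry v]
    rw [map_add]
    exact (congrArg _ (hS (b t) _)).trans (add_zero _)
  rw [h1, ← awForm0_apply, h2, ← ht, hbt, ← ipForm_apply, map_add, LinearMap.add_apply,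
    ipForm_apply, ipForm_apply, hR, LinearMap.neg_apply, ← ipForm_apply, map_neg,
    LinearMap.neg_apply, ipForm_apply, LinearMap.comp_apply, hR]
  ring

theorem exists_isSemidiscreteSolution (hΩ : IsOpen Ω) (hf : IsSource Ω tbar f) {ψ : E d → ℝ}
    (hψ : MemH20 Ω ψ) (j : ℕ) :
    ∃ u : ℝ → Vh0 M k, IsSemidiscreteSolution M k j tbar f ψ u := by
  classical
  obtain ⟨S, hS⟩ := exists_boundary_lift M k j
  obtain ⟨w, w', hw, hw0⟩ := exists_solvesScheme hf j hS (Qh M k ψ).1 (c := 0) (by simp)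
  refine ⟨fun t => if t = 0 then ⟨Qh M k ψ, Qh_mem M hΩ k hψ⟩ else w t, by simp, w, w', hw,
    fun t ht => if_neg ht.1.ne', ?_⟩
  rw [hw0, add_zero]
  simp only [↓reduceIte]
  exact (add_zero _).symm

/-- The equations without interior test functions hold up to `t = 0` by continuity. -/
theorem SolvesScheme.aw_eq_zero {j : ℕ} {w w' : ℝ → Vh0 M k} (h0 : 0 < tbar)
    (h : SolvesScheme M k j tbar f w w') {v : Vh0 M k} (hv : v.1.1 = 0) :
    ∀ t ∈ Icc 0 tbar, aw M j (w t).1 v.1 = 0 := by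
  refine h.1.eq_zero_of_ae h0 ((awForm0 k M j).flip v) ?_
  filter_upwards [h.2] with t ht
  have h1 := ht v
  rw [hv, ← ipForm_apply, map_zero, zero_add] at h1
  simpa [load] using h1

theorem exists_continuous_iff (hΩ : IsOpen Ω) (h0 : 0 < tbar) (hf : IsSource Ω tbar f)
    {ψ : E d → ℝ} (hψ : MemH20 Ω ψ) (j : ℕ) :
    (∃ u u' : ℝ → Vh0 M k, SolvesScheme M k j tbar f u u' ∧ (u 0).1 = Qh M k ψ) ↔
      ∀ v : Vh0 M k, v.1.1 = 0 → aw M j (Qh M k ψ) v.1 = 0 := by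
  constructor
  · rintro ⟨u, u', hu, hu0⟩ v hv
    rw [← hu0]
    exact hu.aw_eq_zero h0 hv 0 ⟨le_rfl, h0.le⟩
  · intro h
    obtain ⟨S, hS⟩ := exists_boundary_lift M k j
    let q : Vh0 M k := ⟨Qh M k ψ, Qh_mem M hΩ k hψ⟩
    let β := bdryPart k M q - S (intPart k M q)
    have hq : q = incInt k M (intPart k M q) + incBdry k M (S (intPart k M q)) +
        incBdry k M β := by
      nth_rw 1 [← incInt_add_incBdry q]
      rw [add_assoc, ← map_add, add_sub_cancel]
    -- the difference between `Q_h ψ` and the lift of its interior component has zero energy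
    have hβ : aw M j (incBdry k M β).1 (incBdry k M β).1 = 0 := by
      have h1 : awForm0 k M j q (incBdry k M β) = 0 := h (incBdry k M β) rfl
      rw [hq, map_add, LinearMap.add_apply, hS, zero_add] at h1
      exact h1
    obtain ⟨w, w', hw, hw0⟩ := exists_solvesScheme hf j hS (intPart k M q) (c := incBdry k M β)
      fun v => aw_eq_zero_of_aw_self hβ v.1
    exact ⟨w, w', hw, by rw [hw0, ← hq]⟩

/-! ### The matrix form -/

section Matrix
variable {ι κ ρ : Type*}
  (φ : Module.Basis ι ℝ (IntSpace k M)) (χ : Module.Basis κ ℝ (faceSpace M k))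
  (ς : Module.Basis ρ ℝ (faceSpace M (k - 1)))

theorem coe_incInt_basis (i : ι) : (incInt k M (φ i)).1 = intVec φ i := rfl

theorem coe_incBdry_basis (i : κ ⊕ ρ) : (incBdry k M (χ.prod ς i)).1 = bdryVec χ ς i := by
  rcases i with i | i
  · simp [bdryVec]
    rfl
  · simp [bdryVec]
    rfl

variable [Fintype ι] [Fintype κ] [Fintype ρ]

/-- Synthesis of an element of `V_h^0` from the coefficients of its interior component. -/
def intOf : (ι → ℝ) →ₗ[ℝ] Vh0 M k := incInt k M ∘ₗ φ.equivFun.symm.toLinearMap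

/-- Synthesis of an element of `V_h^0` from the coefficients of its boundary components. -/
def bdryOf : (κ ⊕ ρ → ℝ) →ₗ[ℝ] Vh0 M k := incBdry k M ∘ₗ (χ.prod ς).equivFun.symm.toLinearMap

theorem coe_intOf (b : ι → ℝ) : (intOf φ b).1 = ∑ i, b i • intVec φ i := by
  simp only [intOf, LinearMap.comp_apply, LinearEquiv.coe_coe, Module.Basis.equivFun_symm_apply,
    map_sum, map_smul, Submodule.coe_sum, Submodule.coe_smul, coe_incInt_basis]

theorem coe_bdryOf (β : κ ⊕ ρ → ℝ) : (bdryOf χ ς β).1 = ∑ l, β l • bdryVec χ ς l := by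
  simp only [bdryOf, LinearMap.comp_apply, LinearEquiv.coe_coe, Module.Basis.equivFun_symm_apply,
    map_sum, map_smul, Submodule.coe_sum, Submodule.coe_smul, coe_incBdry_basis]

theorem stiff_mulVec {α β : Type*} [Fintype β] (j : ℕ) (x : α → Vh M k) (y : β → Vh M k)
    (b : β → ℝ) (a : α) :
    (stiff M j x y).mulVec b a = aw M j (∑ i, b i • y i) (x a) := by
  rw [← awForm_apply, map_sum, LinearMap.sum_apply]
  simp [Matrix.mulVec, dotProduct, stiff, mul_comm]

theorem mass_mulVec (b : ι → ℝ) (a : ι) :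
    (mass M φ).mulVec b a = ip0 M (φ.equivFun.symm b) (φ a) := by
  rw [← ipForm_apply, Module.Basis.equivFun_symm_apply, map_sum, LinearMap.sum_apply]
  simp [Matrix.mulVec, dotProduct, mass, mul_comm]

theorem intOf_add_bdryOf (v : Vh0 M k) :
    intOf φ (φ.equivFun (intPart k M v)) + bdryOf χ ς ((χ.prod ς).equivFun (bdryPart k M v)) =
      v := by
  simp only [intOf, bdryOf, LinearMap.comp_apply, LinearEquiv.coe_coe, LinearEquiv.symm_apply_apply]
  exact incInt_add_incBdry v

set_option maxHeartbeats 800000 in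
/-- The scheme at a fixed time, tested with the basis functions. -/
theorem scheme_iff_matrix (j : ℕ) {g : E d → ℝ}
    (hg : ∃ l : Module.Dual ℝ (IntSpace k M), ∀ v, l v = load M g v)
    (b b' : ι → ℝ) (β : κ ⊕ ρ → ℝ) :
    (∀ v : Vh0 M k, ip0 M (φ.equivFun.symm b') v.1.1 +
        aw M j (intOf φ b + bdryOf χ ς β).1 v.1 = load M g v.1.1) ↔
      (mass M φ).mulVec b' + ((stiff M j (intVec φ) (intVec φ)).mulVec b +
          (stiff M j (intVec φ) (bdryVec χ ς)).mulVec β) = (fun i => load M g (φ i)) ∧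
        (stiff M j (bdryVec χ ς) (intVec φ)).mulVec b +
          (stiff M j (bdryVec χ ς) (bdryVec χ ς)).mulVec β = 0 := by
  obtain ⟨l, hl⟩ := hg
  have ha : ∀ v : Vh M k, aw M j (intOf φ b + bdryOf χ ς β).1 v =
      aw M j (intOf φ b).1 v + aw M j (bdryOf χ ς β).1 v := fun v => aw_add_left j _ _ v
  let Z : Module.Dual ℝ (Vh0 M k) := (ipForm k M (φ.equivFun.symm b') - l) ∘ₗ intPart k M +
    awForm0 k M j (intOf φ b + bdryOf χ ς β)
  have hZ : ∀ v, Z v = ip0 M (φ.equivFun.symm b') v.1.1 - load M g v.1.1 +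
      aw M j (intOf φ b + bdryOf χ ς β).1 v.1 := fun v => by
    simp only [Z, LinearMap.add_apply, LinearMap.comp_apply, LinearMap.sub_apply, ipForm_apply, hl,
      awForm0_apply, intPart_apply]
  have h1 : (∀ v : Vh0 M k, ip0 M (φ.equivFun.symm b') v.1.1 +
        aw M j (intOf φ b + bdryOf χ ς β).1 v.1 = load M g v.1.1) ↔ ∀ v, Z v = 0 := by
    refine forall_congr' fun v => ?_
    rw [hZ, ← sub_eq_zero]
    ring_nf
  obtain ⟨y, hy⟩ : ∃ y : κ ⊕ ρ → Vh0 M k, ∀ i, y i = incBdry k M (χ.prod ς i) :=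
    ⟨_, fun i => rfl⟩
  have hy0 : ∀ i, (y i).1.1 = 0 := fun i => congrArg (intPart k M) (hy i)
  have hyb : ∀ i, (y i).1 = bdryVec χ ς i := fun i =>
    (congrArg Subtype.val (hy i)).trans (coe_incBdry_basis χ ς i)
  have h2 : (∀ v, Z v = 0) ↔ (∀ i, Z (incInt k M (φ i)) = 0) ∧ ∀ i, Z (y i) = 0 := by
    refine ⟨fun h => ⟨fun i => h _, fun i => h _⟩, fun h v => ?_⟩
    have h3 : Z ∘ₗ incInt k M = 0 := φ.ext h.1
    have h4 : Z ∘ₗ incBdry k M = 0 := (χ.prod ς).ext fun i =>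
      (congrArg Z (hy i)).symm.trans (h.2 i)
    rw [← incInt_add_incBdry v, map_add]
    exact (congrArg₂ (· + ·) (LinearMap.congr_fun h3 _) (LinearMap.congr_fun h4 _)).trans
      (add_zero _)
  rw [h1, h2, funext_iff, funext_iff]
  refine and_congr (forall_congr' fun i => ?_) (forall_congr' fun i => ?_)
  · rw [hZ, ha, Pi.add_apply, Pi.add_apply, mass_mulVec, stiff_mulVec, stiff_mulVec, ← coe_intOf,
      ← coe_bdryOf, coe_incInt_basis, ← sub_eq_zero (b := load M g (φ i))]
    have : (intVec φ i).1 = φ i := rfl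
    rw [this]
    ring_nf
  · have h5 : ip0 M (φ.equivFun.symm b') 0 - load M g 0 = 0 :=
      (congrArg (_ - ·) (hl _).symm).trans (map_zero (ipForm k M (φ.equivFun.symm b') - l))
    change _ ↔ (stiff M j (bdryVec χ ς) (intVec φ)).mulVec b i +
      (stiff M j (bdryVec χ ς) (bdryVec χ ς)).mulVec β i = 0
    rw [hZ, hy0, h5, zero_add, ha, stiff_mulVec, stiff_mulVec, ← coe_intOf, ← coe_bdryOf, hyb]

variable [DecidableEq ι] [DecidableEq κ] [DecidableEq ρ]

theorem isUnit_det_of_mulVec {A : Matrix ι ι ℝ} (h : ∀ b, A.mulVec b = 0 → b = 0) :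
    IsUnit A.det := by
  rw [← Matrix.isUnit_iff_isUnit_det, ← Matrix.mulVec_injective_iff_isUnit]
  intro x y hxy
  refine sub_eq_zero.1 (h _ ?_)
  rw [Matrix.mulVec_sub]
  exact sub_eq_zero.2 hxy

theorem isUnit_det_mass : IsUnit (mass M φ).det := by
  refine isUnit_det_of_mulVec fun b hb => ?_
  have h1 : ipForm k M (φ.equivFun.symm b) = 0 := φ.ext fun a => by
    rw [ipForm_apply, ← mass_mulVec, hb]
    rfl
  exact φ.equivFun.symm.map_eq_zero_iff.1
    (eq_zero_of_ip0_self (LinearMap.congr_fun h1 (φ.equivFun.symm b)))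

/-- The degrees for which the weak Laplacian is injective on the weak functions without interior
component. -/
def Unisolvent (M : PolytopalMesh d Ω) (k j : ℕ) : Prop :=
  ∀ v : Vh M k, v.1 = 0 → aw M j v v = 0 → v = 0

theorem isUnit_det_stiff {j : ℕ} (hj : Unisolvent M k j) :
    IsUnit (stiff M j (bdryVec χ ς) (bdryVec χ ς)).det := by
  refine isUnit_det_of_mulVec fun β hβ => ?_
  have h1 : awForm0 k M j (bdryOf χ ς β) ∘ₗ incBdry k M = 0 := (χ.prod ς).ext fun l => by
    have := congrFun hβ l
    rw [stiff_mulVec, ← coe_bdryOf, ← coe_incBdry_basis] at this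
    exact this
  have h2 := hj (bdryOf χ ς β).1 rfl (LinearMap.congr_fun h1 ((χ.prod ς).equivFun.symm β))
  have h3 : bdryOf χ ς β = 0 := Subtype.ext h2
  have h4 : (χ.prod ς).equivFun.symm β = 0 := congrArg (bdryPart k M) h3
  exact (χ.prod ς).equivFun.symm.map_eq_zero_iff.1 h4

/-- Block elimination of the unknown `β`. -/
theorem reduced_iff {κ' : Type*} [Fintype κ'] [DecidableEq κ'] {C A₀₀ : Matrix ι ι ℝ}
    {A₀ : Matrix ι κ' ℝ} {A₁ : Matrix κ' ι ℝ} {A : Matrix κ' κ' ℝ} (hC : IsUnit C.det)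
    (hA : IsUnit A.det) (b b' F : ι → ℝ) (β : κ' → ℝ) :
    (C.mulVec b' + (A₀₀.mulVec b + A₀.mulVec β) = F ∧ A₁.mulVec b + A.mulVec β = 0) ↔
      β = (-(A⁻¹ * A₁)).mulVec b ∧
        b' = C⁻¹.mulVec F + C⁻¹.mulVec ((A₀ * A⁻¹ * A₁ - A₀₀).mulVec b) := by
  have h1 : A₁.mulVec b + A.mulVec β = 0 ↔ β = (-(A⁻¹ * A₁)).mulVec b := by
    rw [Matrix.neg_mulVec, ← Matrix.mulVec_mulVec]
    constructor
    · intro h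
      have h2 := congrArg A⁻¹.mulVec (eq_neg_of_add_eq_zero_right h)
      rwa [Matrix.mulVec_mulVec, Matrix.nonsing_inv_mul _ hA, Matrix.one_mulVec,
        Matrix.mulVec_neg] at h2
    · rintro rfl
      rw [Matrix.mulVec_neg, Matrix.mulVec_mulVec, Matrix.mul_nonsing_inv _ hA, Matrix.one_mulVec,
        add_neg_cancel]
  rw [h1, and_comm]
  refine and_congr_right fun hβ => ?_
  have h3 : (A₀ * A⁻¹ * A₁ - A₀₀).mulVec b = -(A₀₀.mulVec b + A₀.mulVec β) := by
    rw [hβ, Matrix.sub_mulVec, Matrix.mulVec_mulVec, Matrix.mul_neg, Matrix.neg_mulVec,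
      Matrix.mul_assoc]
    abel
  rw [h3, ← Matrix.mulVec_add]
  constructor
  · rintro rfl
    rw [add_neg_cancel_right, Matrix.mulVec_mulVec, Matrix.nonsing_inv_mul _ hC, Matrix.one_mulVec]
  · rintro rfl
    rw [Matrix.mulVec_mulVec, Matrix.mul_nonsing_inv _ hC, Matrix.one_mulVec]
    abel

/-- The semi-discrete scheme is equivalent to the reduced system: almost everywhere by elimination
of the boundary coefficients, and for all positive times by continuity. -/
theorem isSemidiscreteSolution_iff {j : ℕ} (hj : Unisolvent M k j) (h0 : 0 < tbar)
    (hf : IsSource Ω tbar f) (ψ : E d → ℝ) (u : ℝ → Vh0 M k) :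
    IsSemidiscreteSolution M k j tbar f ψ u ↔ SolvesReduced M k j φ χ ς tbar f ψ u := by
  have hC := isUnit_det_mass φ
  have hA := isUnit_det_stiff χ ς hj
  have hl : ∀ᵐ t ∂(volume.restrict (Ioc 0 tbar)),
      ∃ l : Module.Dual ℝ (IntSpace k M), ∀ v, l v = load M (f t) v := by
    filter_upwards [ae_integrable_source M hf] with t ht using exists_load_linear k ht
  let P : Matrix (κ ⊕ ρ) ι ℝ := -((stiff M j (bdryVec χ ς) (bdryVec χ ς))⁻¹ *
    stiff M j (bdryVec χ ς) (intVec φ))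
  constructor
  · rintro ⟨hu0, w, w', ⟨hw, hsch⟩, huw, huw0⟩
    let b : ℝ → ι → ℝ := fun t => φ.equivFun (intPart k M (w t))
    let b' : ℝ → ι → ℝ := fun t => φ.equivFun (intPart k M (w' t))
    let β : ℝ → κ ⊕ ρ → ℝ := fun t => (χ.prod ς).equivFun (bdryPart k M (w t))
    have hwt : ∀ t, intOf φ (b t) + bdryOf χ ς (β t) = w t := fun t => intOf_add_bdryOf φ χ ς _
    have hae : ∀ᵐ t ∂(volume.restrict (Ioc 0 tbar)), β t = P.mulVec (b t) ∧
        b' t = (mass M φ)⁻¹.mulVec (fun i => load M (f t) (φ i)) + (mass M φ)⁻¹.mulVec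
          ((stiff M j (intVec φ) (bdryVec χ ς) * (stiff M j (bdryVec χ ς) (bdryVec χ ς))⁻¹ *
            stiff M j (bdryVec χ ς) (intVec φ) -
              stiff M j (intVec φ) (intVec φ)).mulVec (b t)) := by
      filter_upwards [hl, hsch] with t ht hs
      rw [← reduced_iff hC hA, ← scheme_iff_matrix φ χ ς j ht]
      intro v
      rw [hwt, LinearEquiv.symm_apply_apply]
      exact hs v
    have hβ : ∀ t ∈ Icc 0 tbar, β t = P.mulVec (b t) := by
      intro t ht
      ext l
      have h1 := hw.eq_zero_of_ae h0 (LinearMap.proj l ∘ₗ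
        ((χ.prod ς).equivFun.toLinearMap ∘ₗ bdryPart k M -
          P.mulVecLin ∘ₗ φ.equivFun.toLinearMap ∘ₗ intPart k M)) (by
        filter_upwards [hae] with t ht
        exact sub_eq_zero.2 (congrFun ht.1 l)) t ht
      exact sub_eq_zero.1 h1
    refine ⟨hu0, b, b', hw.comp (φ.equivFun.toLinearMap ∘ₗ intPart k M), fun i => ?_,
      hae.mono fun t ht => ht.2, fun t ht => ?_⟩
    · rw [← hu0, huw0]
      rfl
    · rw [huw t ht, ← hwt t, hβ t (Ioc_subset_Icc_self ht), Submodule.coe_add, coe_intOf,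
        coe_bdryOf]
  · rintro ⟨hu0, b, b', hb, hb0, hode, hu⟩
    let W : (ι → ℝ) →ₗ[ℝ] Vh0 M k := intOf φ + bdryOf χ ς ∘ₗ P.mulVecLin
    have hW1 : ∀ b, (W b).1.1 = φ.equivFun.symm b := fun b => add_zero _
    refine ⟨hu0, fun t => W (b t), fun t => W (b' t), ⟨hb.comp W, ?_⟩, fun t ht => ?_, ?_⟩
    · filter_upwards [hl, hode] with t ht hbt
      have h1 := (scheme_iff_matrix φ χ ς j ht (b t) (b' t) (P.mulVec (b t))).2
        ((reduced_iff hC hA _ _ _ _).2 ⟨rfl, hbt⟩)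
      intro v
      rw [hW1]
      exact h1 v
    · refine Subtype.ext ((hu t ht).trans ?_)
      rw [← coe_intOf, ← coe_bdryOf]
      rfl
    · rw [hu0, hW1]
      exact (φ.equivFun.symm_apply_eq.2 (funext fun i => hb0 i)).symm

/-- The coefficients of the difference of two solutions solve a homogeneous linear system. -/
theorem SolvesReduced.unique {j : ℕ} {ψ : E d → ℝ} {u₁ u₂ : ℝ → Vh0 M k}
    (h₁ : SolvesReduced M k j φ χ ς tbar f ψ u₁) (h₂ : SolvesReduced M k j φ χ ς tbar f ψ u₂) :
    ∀ t ∈ Icc 0 tbar, u₁ t = u₂ t := by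
  obtain ⟨h₁0, b₁, b₁', hb₁, hb₁0, hode₁, hu₁⟩ := h₁
  obtain ⟨h₂0, b₂, b₂', hb₂, hb₂0, hode₂, hu₂⟩ := h₂
  have hb : ∀ t ∈ Icc 0 tbar, b₁ t - b₂ t = 0 := by
    refine eq_zero_of_isH1_linear ((mass M φ)⁻¹.mulVecLin ∘ₗ (stiff M j (intVec φ) (bdryVec χ ς) *
      (stiff M j (bdryVec χ ς) (bdryVec χ ς))⁻¹ * stiff M j (bdryVec χ ς) (intVec φ) -
        stiff M j (intVec φ) (intVec φ)).mulVecLin) (hb₁.sub hb₂) ?_ ?_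
    · ext i
      simp [hb₁0, hb₂0]
    · filter_upwards [hode₁, hode₂] with t h1 h2
      rw [h1, h2, map_sub]
      exact add_sub_add_left_eq_sub _ _ _
  intro t ht
  refine Subtype.ext ?_
  rcases ht.1.eq_or_lt with rfl | h0
  · rw [h₁0, h₂0]
  · rw [hu₁ t ⟨h0, ht.2⟩, hu₂ t ⟨h0, ht.2⟩, sub_eq_zero.1 (hb t ht)]

end Matrix

theorem IsSemidiscreteSolution.unique {j : ℕ} (hj : Unisolvent M k j) (h0 : 0 < tbar)
    (hf : IsSource Ω tbar f) {ψ : E d → ℝ} {u₁ u₂ : ℝ → Vh0 M k}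
    (h₁ : IsSemidiscreteSolution M k j tbar f ψ u₁)
    (h₂ : IsSemidiscreteSolution M k j tbar f ψ u₂) : ∀ t ∈ Icc 0 tbar, u₁ t = u₂ t := by
  let φ := Module.finBasis ℝ (IntSpace k M)
  let χ := Module.finBasis ℝ (faceSpace M k)
  let ς := Module.finBasis ℝ (faceSpace M (k - 1))
  rw [isSemidiscreteSolution_iff φ χ ς hj h0 hf ψ] at h₁ h₂
  exact h₁.unique φ χ ς h₂

end SFWG
end

theorem mainTheorem5 (d : ℕ) (hd : d = 2 ∨ d = 3) (Ω : Set (SFWG.E d)) (hΩ : IsOpen Ω)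
    (M : SFWG.PolytopalMesh d Ω) (k : ℕ) (hk : 2 ≤ k) :
    (∀ (j : ℕ) (tbar : ℝ) (f : ℝ → SFWG.E d → ℝ) (ψ : SFWG.E d → ℝ),
      0 < tbar → SFWG.IsSource Ω tbar f → SFWG.MemH20 Ω ψ →
        (∃ u : ℝ → SFWG.Vh0 M k, SFWG.IsSemidiscreteSolution M k j tbar f ψ u) ∧
        ((∃ u u' : ℝ → SFWG.Vh0 M k,
            SFWG.SolvesScheme M k j tbar f u u' ∧ (u 0).1 = SFWG.Qh M k ψ) ↔
          ∀ v : SFWG.Vh0 M k, v.1.1 = 0 → SFWG.aw M j (SFWG.Qh M k ψ) v.1 = 0)) ∧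
    ∃ j₀ : ℕ, ∀ j ≥ j₀,
      (∀ (tbar : ℝ) (f : ℝ → SFWG.E d → ℝ) (ψ : SFWG.E d → ℝ),
        0 < tbar → SFWG.IsSource Ω tbar f → SFWG.MemH20 Ω ψ →
          ∀ u₁ u₂ : ℝ → SFWG.Vh0 M k,
            SFWG.IsSemidiscreteSolution M k j tbar f ψ u₁ →
            SFWG.IsSemidiscreteSolution M k j tbar f ψ u₂ →
            ∀ t ∈ Set.Icc 0 tbar, u₁ t = u₂ t) ∧
      (∀ (m n p : ℕ)
        (φ : Module.Basis (Fin m) ℝ (∀ T : M.elems, SFWG.polyOn k T.1))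
        (χ : Module.Basis (Fin n) ℝ (SFWG.faceSpace M k))
        (ς : Module.Basis (Fin p) ℝ (SFWG.faceSpace M (k - 1))),
        IsUnit (SFWG.mass M φ).det ∧
        IsUnit (SFWG.stiff M j (SFWG.bdryVec χ ς) (SFWG.bdryVec χ ς)).det ∧
        ∀ (tbar : ℝ) (f : ℝ → SFWG.E d → ℝ) (ψ : SFWG.E d → ℝ),
          0 < tbar → SFWG.IsSource Ω tbar f → SFWG.MemH20 Ω ψ →
            ∀ u : ℝ → SFWG.Vh0 M k,
              SFWG.IsSemidiscreteSolution M k j tbar f ψ u ↔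
                SFWG.SolvesReduced M k j φ χ ς tbar f ψ u) := by
  refine ⟨fun j tbar f ψ h0 hf hψ => ⟨SFWG.exists_isSemidiscreteSolution hΩ hf hψ j,
    SFWG.exists_continuous_iff hΩ h0 hf hψ j⟩, ?_⟩
  obtain ⟨j₀, hj₀⟩ := SFWG.exists_degree_unisolvent M k
  refine ⟨j₀, fun j hj => ⟨fun tbar f ψ h0 hf hψ u₁ u₂ h₁ h₂ =>
    SFWG.IsSemidiscreteSolution.unique (hj₀ j hj) h0 hf h₁ h₂, fun m n p φ χ ς =>
    ⟨SFWG.isUnit_det_mass φ, SFWG.isUnit_det_stiff χ ς (hj₀ j hj), fun tbar f ψ h0 hf hψ u =>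
      SFWG.isSemidiscreteSolution_iff φ χ ς (hj₀ j hj) h0 hf ψ u⟩⟩⟩
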